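/- Let $\mathcal H$ be a separable complex Hilbert space, and let $A,B:D\subset\mathcal H\to\mathcal H$ be (possibly unbounded) self-adjoint operators with the same domain $D$. Let $\Omega\subset\mathbb R$ be a bounded Borel set and $\delta>0$ such that $$\operatorname{dist}(\sigma(A)\cap\Omega,\ \sigma(B)\setminus\Omega)\ge\delta,\qquad \operatorname{dist}(\sigma(B)\cap\Omega,\ \sigma(A)\setminus\Omega)\ge\delta,$$ where the distance to or from the empty set is $+\infty$. Suppose that $A$ and $B$ have only point spectrum in $\Omega$, that is, for every $x\in\mathcal H$ the spectral measures of $A$ and of $B$ at $x$ vanish on the part of $\Omega$ that contains no eigenvalue of $A$, respectively of $B$. Let $\chi_\Omega(A)$ and $\chi_\Omega(B)$ denote the spectral projections of $A$ and $B$ for $\Omega$. Then the ranges of $\chi_\Omega(A)$ and $\chi_\Omega(B)$ lie in $D$, so that $(A-B)\chi_\Omega(A)$ and $(A-B)\chi_\Omega(B)$ are defined on all of $\mathcal H$, and $$\|\chi_\Omega(A)-\chi_\Omega(B)\|_2\le\delta^{-1}\left(\|(A-B)\chi_\Omega(A)\|_2^2+\|(A-B)\chi_\Omega(B)\|_2^2\right)^{1/2},$$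 where $\|\cdot\|_2$ is the Hilbert–Schmidt norm with values in $[0,\infty]$ ($+\infty$ for an operator that is not Hilbert–Schmidt). -/

import Mathlib

open Complex MeasureTheory Filter Topology
open scoped ENNReal InnerProductSpace ComplexOrder CompactlySupported

noncomputable section

namespace SpectralTheory

variable {H : Type*} [NormedAddCommGroup H] [InnerProductSpace ℂ H]

/-! ### Resolvent, spectrum and eigenvalues of an unbounded operator -/

/-- `R` is the bounded everywhere defined two-sided inverse of `A - z : D(A) → H`. -/
def IsResolventAt (A : H →ₗ.[ℂ] H) (z : ℂ) (R : H →L[ℂ] H) : Prop :=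
  (∀ y : H, ∃ hy : R y ∈ A.domain, A ⟨R y, hy⟩ - z • R y = y) ∧
    ∀ x : A.domain, R (A x - z • (x : H)) = x

/-- The resolvent set of `A`. -/
def resolventSet (A : H →ₗ.[ℂ] H) : Set ℂ :=
  {z | ∃ R : H →L[ℂ] H, IsResolventAt A z R}

/-- The spectrum `σ(A)`, as a set of real numbers; `A` will be self-adjoint, so that
its spectrum is real, see `mem_resolventSet_of_im_ne_zero`. -/
def realSpectrum (A : H →ₗ.[ℂ] H) : Set ℝ :=
  {t | (t : ℂ) ∉ resolventSet A}

/-- The set of (real) eigenvalues of `A`. -/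
def eigenvalues (A : H →ₗ.[ℂ] H) : Set ℝ :=
  {t | ∃ x : A.domain, (x : H) ≠ 0 ∧ A x = (t : ℂ) • (x : H)}

open Classical in
/-- The resolvent `(A - z)⁻¹` (and `0` if `z` is not in the resolvent set). -/
def resolvent (A : H →ₗ.[ℂ] H) (z : ℂ) : H →L[ℂ] H :=
  if h : ∃ R : H →L[ℂ] H, IsResolventAt A z R then h.choose else 0

/-- The Cayley transform `(A - i)(A + i)⁻¹ = 1 - 2i (A + i)⁻¹`, a unitary operator if `A` is
self-adjoint, see `cayley_mem_unitary`. -/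
def cayley (A : H →ₗ.[ℂ] H) : H →L[ℂ] H :=
  1 - (2 * I) • resolvent A (-I)

/-- The scalar Cayley transform `t ↦ (t - i) / (t + i)`, which maps `ℝ` bijectively onto the unit
circle without the point `1`. -/
def cayleyMap (t : ℝ) : ℂ := (t - I) / (t + I)

lemma ofReal_add_I_ne_zero (t : ℝ) : (t : ℂ) + I ≠ 0 := by
  intro h
  simpa using congrArg Complex.im h

lemma cayleyMap_injective : Function.Injective cayleyMap := by
  intro s t h
  unfold cayleyMap at h
  rw [div_eq_div_iff (ofReal_add_I_ne_zero s) (ofReal_add_I_ne_zero t)] at h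
  have h2 : (2 * I) * ((s : ℂ) - t) = 0 := by linear_combination h
  have h3 : (s : ℂ) - t = 0 := by simpa using h2
  exact_mod_cast sub_eq_zero.mp h3

lemma continuous_cayleyMap : Continuous cayleyMap := by
  unfold cayleyMap
  exact Continuous.div (by fun_prop) (by fun_prop) ofReal_add_I_ne_zero

lemma measurableEmbedding_cayleyMap : MeasurableEmbedding cayleyMap :=
  continuous_cayleyMap.measurableEmbedding cayleyMap_injective

lemma isResolventAt_resolvent {A : H →ₗ.[ℂ] H} {z : ℂ} (hz : z ∈ resolventSet A) :
    IsResolventAt A z (resolvent A z) := by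
  have h : ∃ R : H →L[ℂ] H, IsResolventAt A z R := hz
  unfold resolvent
  rw [dif_pos h]
  exact h.choose_spec

section Complete

variable [CompleteSpace H]

lemma inner_symm_of_isSelfAdjoint {A : H →ₗ.[ℂ] H} (hA : IsSelfAdjoint A) (x y : A.domain) :
    ⟪A x, (y : H)⟫_ℂ = ⟪(x : H), A y⟫_ℂ := by
  have h := LinearPMap.adjoint_isFormalAdjoint hA.dense_domain
  rw [LinearPMap.isSelfAdjoint_def.mp hA] at h
  exact h x y

lemma abs_im_mul_norm_le {A : H →ₗ.[ℂ] H} (hA : IsSelfAdjoint A) (z : ℂ) (x : A.domain) :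
    |z.im| * ‖(x : H)‖ ≤ ‖A x - z • (x : H)‖ := by
  have hre : (⟪(x : H), A x⟫_ℂ).im = 0 := by
    have h := inner_symm_of_isSelfAdjoint hA x x
    have h2 : (starRingEnd ℂ) ⟪(x : H), A x⟫_ℂ = ⟪(x : H), A x⟫_ℂ := by
      rw [inner_conj_symm, h]
    exact Complex.conj_eq_iff_im.mp h2
  have him : (⟪(x : H), A x - z • (x : H)⟫_ℂ).im = - z.im * ‖(x : H)‖ ^ 2 := by
    have h : ⟪(x : H), (x : H)⟫_ℂ = ((‖(x : H)‖ ^ 2 : ℝ) : ℂ) := by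
      rw [inner_self_eq_norm_sq_to_K, Complex.ofReal_pow]; rfl
    rw [inner_sub_right, inner_smul_right, h, Complex.sub_im, hre, Complex.mul_im,
      Complex.ofReal_re, Complex.ofReal_im]
    ring
  have h1 : |z.im| * ‖(x : H)‖ ^ 2 ≤ ‖(x : H)‖ * ‖A x - z • (x : H)‖ := by
    calc |z.im| * ‖(x : H)‖ ^ 2 = |(⟪(x : H), A x - z • (x : H)⟫_ℂ).im| := by
          rw [him, abs_mul, abs_neg, abs_of_nonneg (sq_nonneg ‖(x : H)‖)]
      _ ≤ ‖⟪(x : H), A x - z • (x : H)⟫_ℂ‖ := Complex.abs_im_le_norm _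
      _ ≤ _ := norm_inner_le_norm _ _
  rcases (norm_nonneg (x : H)).eq_or_lt with h | h
  · rw [← h]; simp
  · nlinarith

/-- The spectrum of a self-adjoint operator is real. -/
theorem mem_resolventSet_of_im_ne_zero {A : H →ₗ.[ℂ] H} (hA : IsSelfAdjoint A) {z : ℂ}
    (hz : z.im ≠ 0) : z ∈ resolventSet A := by
  have hpos : 0 < |z.im| := abs_pos.mpr hz
  -- the linear map `A - z`
  let T : A.domain →ₗ[ℂ] H := A.toFun - z • A.domain.subtype
  have hT : ∀ x : A.domain, T x = A x - z • (x : H) := fun x => rfl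
  have hinj : Function.Injective T := by
    rw [← LinearMap.ker_eq_bot, LinearMap.ker_eq_bot']
    intro x hx
    have := abs_im_mul_norm_le hA z x
    rw [← hT, hx, norm_zero] at this
    have h0 : ‖(x : H)‖ = 0 := by nlinarith [norm_nonneg (x : H)]
    exact Subtype.ext (norm_eq_zero.mp h0)
  have hclosed : IsClosed (LinearMap.range T : Set H) := by
    apply isClosed_of_closure_subset
    intro y hy
    obtain ⟨u, hu, hlim⟩ := mem_closure_iff_seq_limit.mp hy
    choose v hv using hu
    have hc : CauchySeq (fun n => (v n : H)) := by
      rw [Metric.cauchySeq_iff]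
      intro ε hε
      obtain ⟨N, hN⟩ := Metric.cauchySeq_iff.mp hlim.cauchySeq (|z.im| * ε) (by positivity)
      refine ⟨N, fun m hm n hn => ?_⟩
      have h1 := hN m hm n hn
      have h2 := abs_im_mul_norm_le hA z (v m - v n)
      rw [← hT, map_sub, hv, hv, ← dist_eq_norm] at h2
      have h3 : ‖((v m - v n : A.domain) : H)‖ = dist (v m : H) (v n) := by
        rw [dist_eq_norm]; rfl
      rw [h3] at h2
      exact lt_of_mul_lt_mul_left (h2.trans_lt h1) hpos.le
    obtain ⟨w, hw⟩ := cauchySeq_tendsto_of_complete hc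
    have hAv : Tendsto (fun n => A (v n)) atTop (𝓝 (y + z • w)) := by
      have : (fun n => A (v n)) = fun n => u n + z • (v n : H) := by
        funext n
        rw [← hv n, hT]; simp
      rw [this]
      exact hlim.add (hw.const_smul z)
    have hgr : (w, y + z • w) ∈ A.graph := by
      have hcl : _root_.IsClosed (A.graph : Set (H × H)) := hA.isClosed
      refine hcl.mem_of_tendsto (hw.prodMk_nhds hAv) (Eventually.of_forall fun n => ?_)
      exact A.mem_graph (v n)
    obtain ⟨x, hx1, hx2⟩ := (LinearPMap.mem_graph_iff A).mp hgr
    refine ⟨x, ?_⟩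
    simp only at hx1 hx2
    rw [hT, hx2, hx1]; simp
  have hrange : LinearMap.range T = ⊤ := by
    have hcomp : CompleteSpace (LinearMap.range T) := hclosed.completeSpace_coe
    rw [← Submodule.orthogonal_eq_bot_iff, Submodule.eq_bot_iff]
    intro y hy
    have hy' : ∀ x : A.domain, ⟪(starRingEnd ℂ) z • y, (x : H)⟫_ℂ = ⟪y, A x⟫_ℂ := by
      intro x
      have h := Submodule.mem_orthogonal' _ _ |>.mp hy (T x) ⟨x, rfl⟩
      rw [hT, inner_sub_right, inner_smul_right] at h
      rw [inner_smul_left, Complex.conj_conj]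
      linear_combination -h
    have hmem : y ∈ A.adjoint.domain :=
      LinearPMap.mem_adjoint_domain_of_exists y ⟨_, hy'⟩
    have hval : A.adjoint ⟨y, hmem⟩ = (starRingEnd ℂ) z • y :=
      LinearPMap.adjoint_apply_eq hA.dense_domain ⟨y, hmem⟩ hy'
    have hgr : (y, (starRingEnd ℂ) z • y) ∈ A.adjoint.graph := by
      rw [← hval]; exact A.adjoint.mem_graph ⟨y, hmem⟩
    rw [LinearPMap.isSelfAdjoint_def.mp hA] at hgr
    obtain ⟨x, hx1, hx2⟩ := (LinearPMap.mem_graph_iff A).mp hgr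
    simp only at hx1 hx2
    have := abs_im_mul_norm_le hA ((starRingEnd ℂ) z) x
    rw [hx2, hx1, sub_self, norm_zero, Complex.conj_im, abs_neg] at this
    exact norm_eq_zero.mp (by nlinarith [norm_nonneg y])
  let e : A.domain ≃ₗ[ℂ] H := LinearEquiv.ofBijective T ⟨hinj, LinearMap.range_eq_top.mp hrange⟩
  have he : ∀ x, e x = A x - z • (x : H) := fun x => rfl
  let R : H →L[ℂ] H := LinearMap.mkContinuous
    (A.domain.subtype ∘ₗ (e.symm : H →ₗ[ℂ] A.domain)) |z.im|⁻¹ (by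
      intro y
      have h := abs_im_mul_norm_le hA z (e.symm y)
      rw [← he, e.apply_symm_apply] at h
      rw [inv_mul_eq_div, le_div_iff₀ hpos, mul_comm]
      exact h)
  have hR : ∀ y, R y = (e.symm y : H) := fun y => rfl
  refine ⟨R, fun y => ⟨by rw [hR]; exact (e.symm y).2, ?_⟩, fun x => ?_⟩
  · have := e.apply_symm_apply y
    rw [he] at this
    exact this
  · rw [hR, ← he, e.symm_apply_apply]

/-- The Cayley transform of a self-adjoint operator is unitary. -/
theorem cayley_mem_unitary {A : H →ₗ.[ℂ] H} (hA : IsSelfAdjoint A) :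
    cayley A ∈ unitary (H →L[ℂ] H) := by
  obtain ⟨h1, h2⟩ := isResolventAt_resolvent
    (mem_resolventSet_of_im_ne_zero hA (z := -I) (by simp))
  set R := resolvent A (-I) with hR
  -- `U (A + i) x = (A - i) x`
  have hU : ∀ x : A.domain, cayley A (A x + I • (x : H)) = A x - I • (x : H) := by
    intro x
    have h := h2 x
    rw [neg_smul, sub_neg_eq_add] at h
    simp only [cayley, ← hR, sub_apply, one_apply_eq_self,
      smul_apply, h]
    module
  have hsq : ∀ x : A.domain, ‖A x - I • (x : H)‖ = ‖A x + I • (x : H)‖ := by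
    intro x
    have hs := inner_symm_of_isSelfAdjoint hA x x
    have : ⟪A x - I • (x : H), A x - I • (x : H)⟫_ℂ = ⟪A x + I • (x : H), A x + I • (x : H)⟫_ℂ := by
      simp only [inner_sub_left, inner_sub_right, inner_add_left, inner_add_right,
        inner_smul_left, inner_smul_right, Complex.conj_I, hs]
      ring
    rw [inner_self_eq_norm_sq_to_K, inner_self_eq_norm_sq_to_K] at this
    have h3 : ‖A x - I • (x : H)‖ ^ 2 = ‖A x + I • (x : H)‖ ^ 2 := by exact_mod_cast this
    exact (sq_eq_sq₀ (norm_nonneg _) (norm_nonneg _)).mp h3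
  have hnorm : ∀ y, ‖cayley A y‖ = ‖y‖ := by
    intro y
    obtain ⟨hy, hy2⟩ := h1 y
    rw [neg_smul, sub_neg_eq_add] at hy2
    have h := hU ⟨R y, hy⟩
    have h' := hsq ⟨R y, hy⟩
    simp only at h h'
    rw [hy2] at h h'
    rw [h, h']
  have hsurj : Function.Surjective (cayley A) := by
    intro y
    obtain ⟨h1', -⟩ := isResolventAt_resolvent
      (mem_resolventSet_of_im_ne_zero hA (z := I) (by simp))
    obtain ⟨hy, hy2⟩ := h1' y
    exact ⟨_, (hU ⟨_, hy⟩).trans hy2⟩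
  let e : H ≃ₗᵢ[ℂ] H := LinearIsometryEquiv.ofSurjective
    ⟨(cayley A : H →ₗ[ℂ] H), hnorm⟩ hsurj
  have := (Unitary.linearIsometryEquiv.symm e).2
  convert this using 1
  ext y
  rfl

end Complete

/-! ### Spectral measures and spectral projections of a bounded normal operator -/

/-- Clipping the values of a compactly supported function to `[0, 1]`. -/
def clip (g : ℂ → ℝ) (hg : Continuous g) (hg' : HasCompactSupport g) : C_c(ℂ, ℝ) where
  toFun z := max 0 (min 1 (g z))
  continuous_toFun := by fun_prop
  hasCompactSupport' := hg'.comp_left (g := fun t : ℝ => max 0 (min 1 t)) (by simp)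

lemma approx_indicator {V : Type*} (F : Finset V) (μ : V → Measure ℂ) [∀ v, IsFiniteMeasure (μ v)]
    {S : Set ℂ} (hS : MeasurableSet S) {ε : ℝ} (hε : 0 < ε) :
    ∃ f : C_c(ℂ, ℝ), (∀ z, 0 ≤ f z ∧ f z ≤ 1) ∧
      ∀ v ∈ F, |∫ z, f z ∂(μ v) - (μ v).real S| ≤ ε := by
  let m : Measure ℂ := ∑ v ∈ F, μ v
  have hm : IsFiniteMeasure m := ⟨by
    rw [Measure.finsetSum_apply]
    exact ENNReal.sum_lt_top.mpr fun v _ => measure_lt_top _ _⟩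
  have hint : Integrable (S.indicator (fun _ => (1 : ℝ))) m :=
    (integrable_const 1).indicator hS
  obtain ⟨g, hg1, hg2, hg3, hgi⟩ := hint.exists_hasCompactSupport_integral_sub_le hε
  have hf : ∀ z, clip g hg3 hg1 z = max 0 (min 1 (g z)) := fun z => rfl
  refine ⟨clip g hg3 hg1, fun z => ?_, fun v hv => ?_⟩
  · rw [hf]
    exact ⟨le_max_left _ _, max_le zero_le_one (min_le_left _ _)⟩
  · have hint' : Integrable (fun z => ‖S.indicator (fun _ => (1 : ℝ)) z - g z‖) m :=
      (hint.sub hgi).norm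
    have hsum : ∀ h : ℂ → ℝ, Integrable h m → ∀ w ∈ F, Integrable h (μ w) :=
      fun h hh => (integrable_finsetSum_measure (f := h)).mp hh
    have hv1 := hsum _ hint v hv
    have hv2 := hsum _ hint' v hv
    have hv3 : Integrable (clip g hg3 hg1) (μ v) :=
      (clip g hg3 hg1).continuous.integrable_of_hasCompactSupport (clip g hg3 hg1).hasCompactSupport
    have h1 : (μ v).real S = ∫ z, S.indicator (fun _ => (1 : ℝ)) z ∂(μ v) := by
      rw [integral_indicator hS]; simp
    have h2 : ∀ z, ‖clip g hg3 hg1 z - S.indicator (fun _ => (1 : ℝ)) z‖ ≤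
        ‖S.indicator (fun _ => (1 : ℝ)) z - g z‖ := by
      intro z
      rw [hf, Real.norm_eq_abs, Real.norm_eq_abs]
      by_cases hz : z ∈ S
      · rw [Set.indicator_of_mem hz]
        rcases le_total (g z) 0 with h | h <;> rcases le_total (g z) 1 with h' | h' <;>
          simp only [min_eq_right h', min_eq_left h', max_eq_left, max_eq_right, h, zero_le_one] <;>
          grind
      · rw [Set.indicator_of_notMem hz]
        grind
    rw [h1, ← integral_sub hv3 hv1]
    calc |∫ z, (clip g hg3 hg1 z - S.indicator (fun _ => (1 : ℝ)) z) ∂(μ v)|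
        ≤ ∫ z, ‖clip g hg3 hg1 z - S.indicator (fun _ => (1 : ℝ)) z‖ ∂(μ v) :=
          (Real.norm_eq_abs _).symm.le.trans (norm_integral_le_integral_norm _)
      _ ≤ ∫ z, ‖S.indicator (fun _ => (1 : ℝ)) z - g z‖ ∂(μ v) :=
          integral_mono (hv3.sub hv1).norm hv2 h2
      _ ≤ ∑ w ∈ F, ∫ z, ‖S.indicator (fun _ => (1 : ℝ)) z - g z‖ ∂(μ w) :=
          Finset.single_le_sum
            (f := fun w => ∫ z, ‖S.indicator (fun _ => (1 : ℝ)) z - g z‖ ∂(μ w))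
            (fun w _ => integral_nonneg fun z => norm_nonneg _) hv
      _ = ∫ z, ‖S.indicator (fun _ => (1 : ℝ)) z - g z‖ ∂m :=
          (integral_finsetSum_measure (hsum _ hint')).symm
      _ ≤ ε := hg2

section Normal

variable [CompleteSpace H]

/-- The continuous functional calculus `f ↦ f(N)` for real-valued compactly supported `f`. -/
def functionOf (N : H →L[ℂ] H) (f : C_c(ℂ, ℝ)) : H →L[ℂ] H :=
  cfc (fun z : ℂ => ((f z : ℝ) : ℂ)) N

lemma functionOf_add (N : H →L[ℂ] H) (f g : C_c(ℂ, ℝ)) :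
    functionOf N (f + g) = functionOf N f + functionOf N g := by
  have hf := f.continuous
  have hg := g.continuous
  unfold functionOf
  rw [← cfc_add (a := N) (fun z : ℂ => ((f z : ℝ) : ℂ)) (fun z : ℂ => ((g z : ℝ) : ℂ))
    (by fun_prop) (by fun_prop)]
  simp

lemma functionOf_smul (N : H →L[ℂ] H) (c : ℝ) (f : C_c(ℂ, ℝ)) :
    functionOf N (c • f) = (c : ℂ) • functionOf N f := by
  have hf := f.continuous
  unfold functionOf
  rw [← cfc_const_mul (c : ℂ) (fun z : ℂ => ((f z : ℝ) : ℂ)) N (by fun_prop)]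
  simp

lemma functionOf_isPositive (N : H →L[ℂ] H) (f : C_c(ℂ, ℝ)) (hf : 0 ≤ f) :
    (functionOf N f).IsPositive := by
  rw [← ContinuousLinearMap.nonneg_iff_isPositive]
  apply cfc_nonneg
  intro z _
  exact_mod_cast hf z

lemma norm_functionOf_le (N : H →L[ℂ] H) (f : C_c(ℂ, ℝ)) {c : ℝ} (hc : 0 ≤ c)
    (h : ∀ z, |f z| ≤ c) : ‖functionOf N f‖ ≤ c := by
  apply norm_cfc_le hc
  intro z _
  simpa using h z

/-- The positive functional `f ↦ ⟨x, f(N) x⟩`. -/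
def spectralFunctional (N : H →L[ℂ] H) (x : H) : C_c(ℂ, ℝ) →ₚ[ℝ] ℝ :=
  PositiveLinearMap.mk₀
    { toFun := fun f => (⟪x, functionOf N f x⟫_ℂ).re
      map_add' := fun f g => by
        rw [functionOf_add, add_apply, inner_add_right, Complex.add_re]
      map_smul' := fun c f => by
        rw [functionOf_smul, smul_apply, inner_smul_right,
          Complex.re_ofReal_mul]
        rfl }
    (fun f hf => (functionOf_isPositive N f hf).re_inner_nonneg_right x)

/-- The spectral measure of a bounded normal operator `N` at the vector `x`: the regular Borel
measure with `∫ f dμ = ⟨x, f(N) x⟩` for `f` continuous with compact support, given by the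
Riesz–Markov–Kakutani theorem. -/
def normalSpectralMeasure (N : H →L[ℂ] H) (x : H) : Measure ℂ :=
  RealRMK.rieszMeasure (spectralFunctional N x)

lemma integral_normalSpectralMeasure (N : H →L[ℂ] H) (x : H) (f : C_c(ℂ, ℝ)) :
    ∫ z, f z ∂(normalSpectralMeasure N x) = (⟪x, functionOf N f x⟫_ℂ).re :=
  RealRMK.integral_rieszMeasure (spectralFunctional N x) f

lemma measure_univ_le (N : H →L[ℂ] H) (x : H) :
    normalSpectralMeasure N x Set.univ ≤ ENNReal.ofReal (‖x‖ ^ 2) := by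
  have hreg : (normalSpectralMeasure N x).Regular := by
    unfold normalSpectralMeasure; infer_instance
  rw [isOpen_univ.measure_eq_iSup_isCompact]
  refine iSup₂_le fun K _ => iSup_le fun hK => ?_
  obtain ⟨f, hf1, hf2, -, hf3⟩ := exists_continuousMap_one_of_isCompact_subset_isOpen hK isOpen_univ
    (Set.subset_univ K)
  let g : C_c(ℂ, ℝ) := ⟨f, hf2⟩
  have hg : ∀ z, g z = f z := fun z => rfl
  have h1 : normalSpectralMeasure N x K ≤ ENNReal.ofReal (spectralFunctional N x g) :=
    RealRMK.rieszMeasure_le_of_eq_one (spectralFunctional N x) (fun z => (hf3 z).1) hK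
      (fun z hz => hf1 hz)
  refine h1.trans (ENNReal.ofReal_le_ofReal ?_)
  have h2 : spectralFunctional N x g = (⟪x, functionOf N g x⟫_ℂ).re := rfl
  have h3 : ‖functionOf N g‖ ≤ 1 := norm_functionOf_le N g zero_le_one fun z => by
    rw [hg, abs_le]
    exact ⟨by linarith [(hf3 z).1], (hf3 z).2⟩
  calc spectralFunctional N x g ≤ ‖⟪x, functionOf N g x⟫_ℂ‖ := h2 ▸ Complex.re_le_norm _
    _ ≤ ‖x‖ * ‖functionOf N g x‖ := norm_inner_le_norm _ _
    _ ≤ ‖x‖ * (1 * ‖x‖) := by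
      gcongr
      exact (functionOf N g).le_of_opNorm_le h3 x
    _ = ‖x‖ ^ 2 := by ring

instance (N : H →L[ℂ] H) (x : H) : IsFiniteMeasure (normalSpectralMeasure N x) :=
  ⟨(measure_univ_le N x).trans_lt ENNReal.ofReal_lt_top⟩

/-- A function that is approximated on finite sets of vectors by the quadratic forms of uniformly
bounded operators is itself the quadratic form of a bounded operator. -/
lemma exists_operator_of_approx (q : H → ℂ) (C : ℝ)
    (hq : ∀ (F : Finset H) (ε : ℝ), 0 < ε →
      ∃ T : H →L[ℂ] H, ‖T‖ ≤ C ∧ ∀ v ∈ F, ‖⟪v, T v⟫_ℂ - q v‖ ≤ ε) :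
    ∃ T : H →L[ℂ] H, ∀ x, ⟪x, T x⟫_ℂ = q x := by
  classical
  have hq' : ∀ i : Finset H × ℕ, ∃ T : H →L[ℂ] H, ‖T‖ ≤ C ∧
      ∀ v ∈ i.1, ‖⟪v, T v⟫_ℂ - q v‖ ≤ 1 / ((i.2 : ℝ) + 1) :=
    fun i => hq i.1 _ (by positivity)
  choose T hTC hT using hq'
  have hlim : ∀ v, Tendsto (fun i => ⟪T i v, v⟫_ℂ) atTop (𝓝 ((starRingEnd ℂ) (q v))) := by
    intro v
    have h1 : Tendsto (fun i => ⟪v, T i v⟫_ℂ) atTop (𝓝 (q v)) := by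
      rw [tendsto_iff_norm_sub_tendsto_zero]
      have h2 : Tendsto (fun i : Finset H × ℕ => 1 / ((i.2 : ℝ) + 1)) atTop (𝓝 0) := by
        rw [← prod_atTop_atTop_eq]
        exact tendsto_one_div_add_atTop_nhds_zero_nat.comp tendsto_snd
      refine squeeze_zero' (Eventually.of_forall fun _ => norm_nonneg _) ?_ h2
      filter_upwards [eventually_ge_atTop (({v} : Finset H), 0)] with i hi
      exact hT i v (hi.1 (Finset.mem_singleton_self v))
    have h3 := (Complex.continuous_conj.tendsto _).comp h1
    refine h3.congr fun i => ?_
    simp only [Function.comp_apply, inner_conj_symm]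
  let B : H → H → ℂ := fun x y =>
    ((starRingEnd ℂ) (q (x + y)) - (starRingEnd ℂ) (q (x - y))
      - I * (starRingEnd ℂ) (q (x + I • y)) + I * (starRingEnd ℂ) (q (x - I • y))) / 4
  have hB : ∀ x y, Tendsto (fun i => ⟪T i x, y⟫_ℂ) atTop (𝓝 (B x y)) := by
    intro x y
    have h := ((((hlim (x + y)).sub (hlim (x - y))).sub
      ((hlim (x + I • y)).const_mul I)).add ((hlim (x - I • y)).const_mul I)).div_const 4
    refine h.congr fun i => ?_
    exact (inner_map_polarization' (T i : H →ₗ[ℂ] H) x y).symm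
  let b : H →ₗ⋆[ℂ] H →ₗ[ℂ] ℂ := LinearMap.mk₂'ₛₗ (starRingEnd ℂ) (RingHom.id ℂ) B
    (fun x x' y => tendsto_nhds_unique (hB (x + x') y)
      (((hB x y).add (hB x' y)).congr fun i => by rw [map_add, inner_add_left]))
    (fun c x y => tendsto_nhds_unique (hB (c • x) y)
      (((hB x y).const_mul ((starRingEnd ℂ) c)).congr fun i => by rw [map_smul, inner_smul_left]))
    (fun x y y' => tendsto_nhds_unique (hB x (y + y'))
      (((hB x y).add (hB x y')).congr fun i => by rw [inner_add_right]))
    (fun c x y => tendsto_nhds_unique (hB x (c • y))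
      (((hB x y).const_mul c).congr fun i => by rw [inner_smul_right]))
  have hb : ∀ x y, ‖b x y‖ ≤ C * ‖x‖ * ‖y‖ := by
    intro x y
    refine le_of_tendsto (hB x y).norm (Eventually.of_forall fun i => ?_)
    calc ‖⟪T i x, y⟫_ℂ‖ ≤ ‖T i x‖ * ‖y‖ := norm_inner_le_norm _ _
      _ ≤ C * ‖x‖ * ‖y‖ := by
        gcongr
        exact (T i).le_of_opNorm_le (hTC i) x
  let b' : H →L⋆[ℂ] H →L[ℂ] ℂ := b.mkContinuous₂ C hb
  refine ⟨InnerProductSpace.continuousLinearMapOfBilin b', fun x => ?_⟩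
  rw [← inner_conj_symm, InnerProductSpace.continuousLinearMapOfBilin_apply]
  have h1 : b' x x = (starRingEnd ℂ) (q x) := tendsto_nhds_unique (hB x x) (hlim x)
  rw [h1, Complex.conj_conj]

/-- The quadratic form `x ↦ μ_x(S)` of a Borel set `S` belongs to a bounded operator. -/
theorem exists_normalSpectralProjection (N : H →L[ℂ] H) {S : Set ℂ} (hS : MeasurableSet S) :
    ∃ T : H →L[ℂ] H, ∀ x, ⟪x, T x⟫_ℂ = (((normalSpectralMeasure N x).real S : ℝ) : ℂ) := by
  refine exists_operator_of_approx _ 1 fun F ε hε => ?_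
  obtain ⟨f, hf, hfε⟩ := approx_indicator F (normalSpectralMeasure N) hS hε
  refine ⟨functionOf N f, norm_functionOf_le N f zero_le_one fun z => ?_, fun v hv => ?_⟩
  · rw [abs_le]
    exact ⟨by linarith [(hf z).1], (hf z).2⟩
  · have h1 := hfε v hv
    have h2 := (functionOf_isPositive N f fun z => (hf z).1).inner_nonneg_right v
    have h3 : ⟪v, functionOf N f v⟫_ℂ = (((⟪v, functionOf N f v⟫_ℂ).re : ℝ) : ℂ) :=
      Complex.ext rfl (by simpa using (Complex.nonneg_iff.mp h2).2.symm)
    rw [h3, ← integral_normalSpectralMeasure, ← Complex.ofReal_sub, Complex.norm_real]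
    exact h1


/-- The spectral projection `χ_S(N)` of a bounded normal operator `N`: the unique bounded operator
with `⟨x, χ_S(N) x⟩ = μ_x(S)` for all `x`. -/
def normalSpectralProjection (N : H →L[ℂ] H) {S : Set ℂ} (hS : MeasurableSet S) : H →L[ℂ] H :=
  (exists_normalSpectralProjection N hS).choose

lemma inner_normalSpectralProjection (N : H →L[ℂ] H) {S : Set ℂ} (hS : MeasurableSet S) (x : H) :
    ⟪x, normalSpectralProjection N hS x⟫_ℂ = (((normalSpectralMeasure N x).real S : ℝ) : ℂ) :=
  (exists_normalSpectralProjection N hS).choose_spec x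

end Normal

/-! ### Spectral measures and spectral projections of an unbounded self-adjoint operator -/

section SelfAdjoint

variable [CompleteSpace H]

/-- The spectral measure `μ_x` on `ℝ` of a self-adjoint operator `A` at the vector `x`: the spectral
measure of the (unitary) Cayley transform of `A`, transported to `ℝ` by the scalar Cayley
transform. -/
def spectralMeasure (A : H →ₗ.[ℂ] H) (x : H) : Measure ℝ :=
  (normalSpectralMeasure (cayley A) x).comap cayleyMap

/-- The spectral projection `χ_Ω(A)` of a self-adjoint operator `A` and a Borel set `Ω ⊆ ℝ`. -/
def spectralProjection (A : H →ₗ.[ℂ] H) {Ω : Set ℝ} (hΩ : MeasurableSet Ω) : H →L[ℂ] H :=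
  normalSpectralProjection (cayley A) (measurableEmbedding_cayleyMap.measurableSet_image.mpr hΩ)

/-- `χ_Ω(A)` is the operator with `⟨x, χ_Ω(A) x⟩ = μ_x(Ω)` for all `x`. -/
theorem inner_spectralProjection (A : H →ₗ.[ℂ] H) {Ω : Set ℝ} (hΩ : MeasurableSet Ω) (x : H) :
    ⟪x, spectralProjection A hΩ x⟫_ℂ = (((spectralMeasure A x).real Ω : ℝ) : ℂ) := by
  rw [spectralProjection, inner_normalSpectralProjection, spectralMeasure, Measure.real,
    Measure.real, measurableEmbedding_cayleyMap.comap_apply]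

/-- `A` has only point spectrum in `Ω`: every spectral measure of `A` is, within `Ω`, carried by the
set of eigenvalues of `A`. This is in particular the case if every `t ∈ σ(A) ∩ Ω` is an eigenvalue,
and (in a separable space) it says that the range of `χ_Ω(A)` is spanned by eigenvectors. -/
def HasOnlyPointSpectrumIn (A : H →ₗ.[ℂ] H) (Ω : Set ℝ) : Prop :=
  ∀ x : H, spectralMeasure A x (Ω \ eigenvalues A) = 0

end SelfAdjoint

/-! ### The Hilbert–Schmidt norm -/

/-- The everywhere defined product `T P`, for an unbounded operator `T` and a bounded operator `P`
whose range lies in the domain of `T`. -/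
def mulOfRange (T : H →ₗ.[ℂ] H) (P : H →L[ℂ] H) (h : ∀ x, P x ∈ T.domain) : H →ₗ[ℂ] H :=
  T.toFun ∘ₗ LinearMap.codRestrict T.domain (P : H →ₗ[ℂ] H) h

lemma tsum_enorm_inner_sq {ι : Type*} (b : HilbertBasis ι ℂ H) (x : H) :
    ∑' i, ‖⟪b i, x⟫_ℂ‖ₑ ^ 2 = ‖x‖ₑ ^ 2 := by
  have h := (b.hasSum_inner_mul_inner x x).mapL Complex.reCLM
  have h1 : ∀ i, Complex.reCLM (⟪x, b i⟫_ℂ * ⟪b i, x⟫_ℂ) = ‖⟪b i, x⟫_ℂ‖ ^ 2 := by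
    intro i
    rw [← inner_conj_symm, Complex.conj_mul', Complex.reCLM_apply]
    norm_cast
  have h2 : Complex.reCLM ⟪x, x⟫_ℂ = ‖x‖ ^ 2 := inner_self_eq_norm_sq (𝕜 := ℂ) x
  simp_rw [h1, h2] at h
  have h3 : ∀ r : H, ‖r‖ₑ ^ 2 = ENNReal.ofReal (‖r‖ ^ 2) := fun r => by
    rw [ENNReal.ofReal_pow (norm_nonneg _), ofReal_norm]
  have h4 : ∀ r : ℂ, ‖r‖ₑ ^ 2 = ENNReal.ofReal (‖r‖ ^ 2) := fun r => by
    rw [ENNReal.ofReal_pow (norm_nonneg _), ofReal_norm]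
  simp_rw [h3, h4]
  rw [← ENNReal.ofReal_tsum_of_nonneg (fun i => sq_nonneg _) h.summable, h.tsum_eq]

variable [CompleteSpace H]

/-- The Hilbert–Schmidt norm `‖T‖₂ = (∑ᵢ ‖T eᵢ‖²)^(1/2) ∈ [0, ∞]`, where `(eᵢ)` is an orthonormal
basis. For bounded `T` it does not depend on the basis, see `hilbertSchmidtNorm_eq`. -/
def hilbertSchmidtNorm (T : H →ₗ[ℂ] H) : ℝ≥0∞ :=
  (∑' i, ‖T ((exists_hilbertBasis ℂ H).choose_spec.choose i)‖ₑ ^ 2) ^ (1 / 2 : ℝ)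

lemma tsum_enorm_sq_eq_adjoint {ι κ : Type*} (b : HilbertBasis ι ℂ H) (c : HilbertBasis κ ℂ H)
    (T : H →L[ℂ] H) : ∑' i, ‖T (b i)‖ₑ ^ 2 = ∑' k, ‖T.adjoint (c k)‖ₑ ^ 2 := by
  simp_rw [← tsum_enorm_inner_sq c (T _), ← tsum_enorm_inner_sq b (T.adjoint _)]
  rw [ENNReal.tsum_comm]
  refine tsum_congr fun k => tsum_congr fun i => ?_
  rw [ContinuousLinearMap.adjoint_inner_right, ← inner_conj_symm, RCLike.enorm_conj]

theorem hilbertSchmidtNorm_eq {ι : Type*} (b : HilbertBasis ι ℂ H) (T : H →L[ℂ] H) :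
    hilbertSchmidtNorm (T : H →ₗ[ℂ] H) = (∑' i, ‖T (b i)‖ₑ ^ 2) ^ (1 / 2 : ℝ) := by
  unfold hilbertSchmidtNorm
  congr 1
  exact (tsum_enorm_sq_eq_adjoint _ b T).trans (tsum_enorm_sq_eq_adjoint b b T).symm

end SpectralTheory

end

/-!
Write `P = χ_Ω(A)` and `Q = χ_Ω(B)`. The operator `P - Q = P (1 - Q) - (1 - P) Q` is a difference of
two operators with orthogonal ranges, and `P (1 - Q)` is the adjoint of `(1 - Q) P`, so that
`‖P - Q‖₂² = ‖(1 - Q) P‖₂² + ‖(1 - P) Q‖₂²` (`hilbertSchmidtNorm_sub_sq`). By symmetry it remains to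
show `δ ‖(1 - Q) P‖₂ ≤ ‖(A - B) P‖₂` (`mul_hilbertSchmidtNorm_one_sub_mul_le`). As `A` has only point
spectrum in `Ω`, there is a Hilbert basis made of eigenvectors of `A` in the range of `P` and of
vectors in the kernel of `P` (`exists_hilbertBasis_eigenspace`). On an eigenvector `e` with eigenvalue
`s ∈ Ω`, the operator `A - B` acts as `s - B`, and `‖(s - B) e‖ ≥ ‖(1 - Q) (s - B) e‖ ≥ δ ‖(1 - Q) e‖`
since `s` has distance at least `δ` from `σ(B) \ Ω` (`mul_norm_sub_spectralProjection_le`). Squaring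
and summing over the basis gives the claim. The Hilbert–Schmidt norm of `(A - B) P` may be computed in
this basis because `(A - B) P` is bounded, by the closed graph theorem.

The facts from spectral theory that this uses are derived from the spectral measures `μ_x` of the
Cayley transform `U` of `A`. The main tools are the isometry `‖f(U) x‖² = ∫ |f|² dμ_x` for continuous
`f` (`norm_cfc_apply_sq`), the fact that `μ_x` lives on the spectrum of `U`, and the strong
approximation of spectral projections by continuous functions of `U`
(`norm_functionOf_sub_normalSpectralProjection_sq_le`), which yields that spectral projections are
orthogonal projections and commute with `U`. Statements about `A` are turned into statements about
continuous functions of `U` through `(A + i)⁻¹ = (1 - U) / (2i)`.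
-/

noncomputable section

namespace SpectralTheory

variable {H : Type*} [NormedAddCommGroup H] [InnerProductSpace ℂ H]

/-! ### Eigenspaces and the Cayley transform of an unbounded operator -/

lemma eigenvalues_subset_realSpectrum (A : H →ₗ.[ℂ] H) : eigenvalues A ⊆ realSpectrum A := by
  rintro t ⟨x, hx, hAx⟩ hres
  have h := (isResolventAt_resolvent hres).2 x
  rw [hAx, sub_self, map_zero] at h
  exact hx h.symm

/-- The eigenspace of `A` at `t`, as a subspace of `H`. It is the zero space if `t` is not an
eigenvalue. -/
def eigenspace (A : H →ₗ.[ℂ] H) (t : ℝ) : Submodule ℂ H :=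
  (LinearMap.ker (A.toFun - (t : ℂ) • A.domain.subtype)).map A.domain.subtype

lemma mem_eigenspace {A : H →ₗ.[ℂ] H} {t : ℝ} {x : H} :
    x ∈ eigenspace A t ↔ ∃ hx : x ∈ A.domain, A ⟨x, hx⟩ = (t : ℂ) • x := by
  simp only [eigenspace, Submodule.mem_map, LinearMap.mem_ker, LinearMap.sub_apply, sub_eq_zero]
  constructor
  · rintro ⟨y, hy, rfl⟩
    exact ⟨y.2, hy⟩
  · rintro ⟨hx, h⟩
    exact ⟨⟨x, hx⟩, h, rfl⟩

lemma resolvent_neg_I_eq (A : H →ₗ.[ℂ] H) :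
    resolvent A (-I) = (2 * I)⁻¹ • (1 - cayley A) := by
  rw [cayley, sub_sub_cancel, smul_smul, inv_mul_cancel₀ (by simp), one_smul]

lemma one_sub_cayleyMap (t : ℝ) : 1 - cayleyMap t = 2 * I / (t + I) := by
  have h := ofReal_add_I_ne_zero t
  rw [cayleyMap]
  field_simp
  ring

lemma exists_cayleyMap_eq {z : ℂ} (hz : ‖z‖ = 1) (hz1 : z ≠ 1) : ∃ t : ℝ, cayleyMap t = z := by
  have h1 : z.re ^ 2 + z.im ^ 2 = 1 := by
    have := Complex.sq_norm z
    rw [hz, Complex.normSq_apply] at this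
    linarith
  have h2 : 1 - z.re ≠ 0 := by
    intro h
    have h3 : z.re = 1 := by linarith
    have h4 : z.im = 0 := by rw [h3] at h1; nlinarith
    exact hz1 (Complex.ext (by simp [h3]) (by simp [h4]))
  refine ⟨-z.im / (1 - z.re), ?_⟩
  rw [cayleyMap, div_eq_iff (ofReal_add_I_ne_zero _)]
  apply Complex.ext
  · simp only [Complex.sub_re, Complex.ofReal_re, Complex.I_re, Complex.mul_re, Complex.add_re,
      Complex.add_im, Complex.ofReal_im, Complex.I_im]
    field_simp
    ring
  · simp only [Complex.sub_im, Complex.ofReal_re, Complex.I_re, Complex.mul_im, Complex.add_re,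
      Complex.add_im, Complex.ofReal_im, Complex.I_im]
    field_simp
    linear_combination h1

variable [CompleteSpace H]

/-! ### Spectral measures of a bounded normal operator -/

instance (N : H →L[ℂ] H) (x : H) : (normalSpectralMeasure N x).Regular := by
  unfold normalSpectralMeasure; infer_instance

lemma normalSpectralMeasure_compl_spectrum (N : H →L[ℂ] H) (x : H) :
    normalSpectralMeasure N x (spectrum ℂ N)ᶜ = 0 := by
  have hopen : IsOpen (spectrum ℂ N)ᶜ := (spectrum.isClosed N).isOpen_compl
  rw [hopen.measure_eq_iSup_isCompact]
  simp only [ENNReal.iSup_eq_zero]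
  intro K hKU hK
  obtain ⟨f, hf1, hf2, hf4, hf3⟩ :=
    exists_continuousMap_one_of_isCompact_subset_isOpen hK hopen hKU
  let g : C_c(ℂ, ℝ) := ⟨f, hf2⟩
  have h1 : normalSpectralMeasure N x K ≤ ENNReal.ofReal (spectralFunctional N x g) :=
    RealRMK.rieszMeasure_le_of_eq_one (spectralFunctional N x) (fun z => (hf3 z).1) hK
      (fun z hz => hf1 hz)
  have h2 : spectralFunctional N x g = (⟪x, functionOf N g x⟫_ℂ).re := rfl
  have h3 : functionOf N g = 0 := by
    unfold functionOf
    rw [← cfc_zero ℂ N]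
    refine cfc_congr fun z hz => ?_
    have : g z = 0 := image_eq_zero_of_notMem_tsupport fun h => hf4 h hz
    simp [this]
  rw [h2, h3] at h1
  simpa using h1

lemma ae_mem_spectrum (N : H →L[ℂ] H) (x : H) :
    ∀ᵐ z ∂(normalSpectralMeasure N x), z ∈ spectrum ℂ N :=
  normalSpectralMeasure_compl_spectrum N x

/-- A continuous function agrees on the spectrum with a compactly supported one. -/
lemma exists_compactlySupported_eqOn_spectrum (N : H →L[ℂ] H) {f : ℂ → ℝ} (hf : Continuous f) :
    ∃ g : C_c(ℂ, ℝ), ∀ z ∈ spectrum ℂ N, g z = f z := by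
  obtain ⟨χ, h1, h2, -, -⟩ := exists_continuousMap_one_of_isCompact_subset_isOpen
    (spectrum.isCompact N) (isOpen_univ (X := ℂ)) (Set.subset_univ _)
  let g : C_c(ℂ, ℝ) :=
    { toFun := fun z => f z * χ z
      continuous_toFun := by fun_prop
      hasCompactSupport' := HasCompactSupport.mul_left (f' := fun z => χ z) h2 }
  refine ⟨g, fun z hz => ?_⟩
  change f z * χ z = f z
  rw [h1 hz]; simp

lemma integrable_normalSpectralMeasure (N : H →L[ℂ] H) (x : H) {f : ℂ → ℝ} (hf : Continuous f) :
    Integrable f (normalSpectralMeasure N x) := by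
  obtain ⟨g, hg⟩ := exists_compactlySupported_eqOn_spectrum N hf
  have h : Integrable g (normalSpectralMeasure N x) :=
    g.continuous.integrable_of_hasCompactSupport g.hasCompactSupport
  refine h.congr ?_
  filter_upwards [ae_mem_spectrum N x] with z hz using hg z hz

lemma integrable_indicator_one_normalSpectralMeasure (N : H →L[ℂ] H) (x : H) {S : Set ℂ}
    (hS : MeasurableSet S) :
    Integrable (fun z => (S.indicator 1 z : ℝ)) (normalSpectralMeasure N x) :=
  (integrable_const (1 : ℝ)).indicator hS

lemma integral_normalSpectralMeasure_of_continuous (N : H →L[ℂ] H) (x : H) {f : ℂ → ℝ}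
    (hf : Continuous f) :
    ∫ z, f z ∂(normalSpectralMeasure N x) =
      (⟪x, cfc (fun z : ℂ => ((f z : ℝ) : ℂ)) N x⟫_ℂ).re := by
  obtain ⟨g, hg⟩ := exists_compactlySupported_eqOn_spectrum N hf
  have h1 : ∫ z, f z ∂(normalSpectralMeasure N x) = ∫ z, g z ∂(normalSpectralMeasure N x) := by
    refine integral_congr_ae ?_
    filter_upwards [ae_mem_spectrum N x] with z hz using (hg z hz).symm
  have h2 : cfc (fun z : ℂ => ((f z : ℝ) : ℂ)) N = functionOf N g :=
    cfc_congr fun z hz => by simp only [hg z hz]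
  rw [h1, h2, integral_normalSpectralMeasure]

/-- The continuous functional calculus, applied to a vector, is isometric for the `L²` norm of the
spectral measure. -/
lemma norm_cfc_apply_sq (N : H →L[ℂ] H) (x : H) {f : ℂ → ℂ} (hf : Continuous f) :
    ‖cfc f N x‖ ^ 2 = ∫ z, ‖f z‖ ^ 2 ∂(normalSpectralMeasure N x) := by
  rw [integral_normalSpectralMeasure_of_continuous N x (by fun_prop)]
  have h1 : cfc (fun z : ℂ => ((‖f z‖ ^ 2 : ℝ) : ℂ)) N = star (cfc f N) * cfc f N := by
    rw [← cfc_star, ← cfc_mul (fun z => star (f z)) f N (by fun_prop) (by fun_prop)]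
    refine cfc_congr fun z _ => ?_
    simp [Complex.conj_mul']
  rw [h1, ContinuousLinearMap.star_eq_adjoint]
  simp only [ContinuousLinearMap.mul_def, ContinuousLinearMap.comp_apply]
  rw [ContinuousLinearMap.adjoint_inner_right]
  exact (inner_self_eq_norm_sq (𝕜 := ℂ) _).symm

lemma measureReal_univ_normalSpectralMeasure (N : H →L[ℂ] H) [hN : IsStarNormal N] (x : H) :
    (normalSpectralMeasure N x).real Set.univ = ‖x‖ ^ 2 := by
  have h := norm_cfc_apply_sq N x (f := fun _ => 1) continuous_const
  rw [cfc_const_one ℂ N hN] at h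
  simpa using h.symm

lemma norm_apply_sub_smul_sq (N : H →L[ℂ] H) [hN : IsStarNormal N] (c : ℂ) (x : H) :
    ‖N x - c • x‖ ^ 2 = ∫ z, ‖z - c‖ ^ 2 ∂(normalSpectralMeasure N x) := by
  rw [← norm_cfc_apply_sq N x (f := fun z => z - c) (by fun_prop),
    cfc_sub (fun z : ℂ => z) (fun _ => c) N (by fun_prop) (by fun_prop),
    cfc_id' ℂ N, cfc_const c N, Algebra.algebraMap_eq_smul_one]
  rfl

/-! ### Spectral projections of a bounded normal operator -/

/-- `L¹` approximation of an indicator function by continuous functions, simultaneously for finitely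
many spectral measures. -/
lemma exists_integral_abs_sub_indicator_le (N : H →L[ℂ] H) {S : Set ℂ} (hS : MeasurableSet S)
    (F : Finset H) {ε : ℝ} (hε : 0 < ε) :
    ∃ f : C_c(ℂ, ℝ), (∀ z, 0 ≤ f z ∧ f z ≤ 1) ∧
      ∀ v ∈ F, ∫ z, |f z - S.indicator 1 z| ∂(normalSpectralMeasure N v) ≤ ε := by
  classical
  -- approximating `1_S` in the integrals over `S` and over `Sᶜ` amounts to approximating in `L¹`
  let μ : H × Bool → Measure ℂ := fun v =>
    (normalSpectralMeasure N v.1).restrict (if v.2 then S else Sᶜ)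
  obtain ⟨f, hf, hfε⟩ := approx_indicator (F ×ˢ Finset.univ) μ hS (half_pos hε)
  refine ⟨f, hf, fun v hv => ?_⟩
  have h1 := hfε (v, true) (by simp [hv])
  have h2 := hfε (v, false) (by simp [hv])
  have hfi : Integrable f (normalSpectralMeasure N v) :=
    integrable_normalSpectralMeasure N v f.continuous
  have hint : Integrable (fun z => |f z - S.indicator 1 z|) (normalSpectralMeasure N v) :=
    (hfi.sub (integrable_indicator_one_normalSpectralMeasure N _ hS)).abs
  simp only [μ, if_true, measureReal_restrict_apply hS, Set.inter_self] at h1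
  simp only [μ, Bool.false_eq_true, if_false, measureReal_restrict_apply hS, Set.inter_compl_self,
    measureReal_empty, sub_zero] at h2
  rw [← integral_add_compl hS hint]
  have h3 : ∫ z in S, |f z - S.indicator 1 z| ∂(normalSpectralMeasure N v) =
      (normalSpectralMeasure N v).real S - ∫ z in S, f z ∂(normalSpectralMeasure N v) := by
    have : (normalSpectralMeasure N v).real S = ∫ z in S, (1 : ℝ) ∂(normalSpectralMeasure N v) := by
      simp
    rw [this, ← integral_sub (integrable_const _) hfi.integrableOn]
    refine setIntegral_congr_fun hS fun z hz => ?_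
    simp only [Set.indicator_of_mem hz, Pi.one_apply]
    rw [abs_sub_comm, abs_of_nonneg (by linarith [(hf z).2])]
  have h4 : ∫ z in Sᶜ, |f z - S.indicator 1 z| ∂(normalSpectralMeasure N v) =
      ∫ z in Sᶜ, f z ∂(normalSpectralMeasure N v) := by
    refine setIntegral_congr_fun hS.compl fun z hz => ?_
    simp only [Set.indicator_of_notMem (show z ∉ S from hz), sub_zero, abs_of_nonneg (hf z).1]
  rw [h3, h4]
  linarith [neg_le_of_abs_le h1, le_of_abs_le h2]

/-- The integrand `(f - g)²` of the left-hand side is at most `|f - g|`, as `f` and `g` take values in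
`[0, 1]`. -/
lemma norm_functionOf_sub_apply_sq_le (N : H →L[ℂ] H) (x : H) {S : Set ℂ} (hS : MeasurableSet S)
    {f g : C_c(ℂ, ℝ)} (hf : ∀ z, 0 ≤ f z ∧ f z ≤ 1) (hg : ∀ z, 0 ≤ g z ∧ g z ≤ 1) :
    ‖functionOf N f x - functionOf N g x‖ ^ 2 ≤
      ∫ z, |f z - S.indicator 1 z| ∂(normalSpectralMeasure N x) +
      ∫ z, |g z - S.indicator 1 z| ∂(normalSpectralMeasure N x) := by
  have hfc := f.continuous
  have hgc := g.continuous
  have h1 : functionOf N f x - functionOf N g x =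
      cfc (fun z : ℂ => ((f z : ℝ) : ℂ) - ((g z : ℝ) : ℂ)) N x := by
    rw [cfc_sub (fun z : ℂ => ((f z : ℝ) : ℂ)) (fun z : ℂ => ((g z : ℝ) : ℂ)) N
      (by fun_prop) (by fun_prop)]
    rfl
  have hi : ∀ h : C_c(ℂ, ℝ), Integrable (fun z => |h z - S.indicator 1 z|)
      (normalSpectralMeasure N x) := fun h =>
    ((integrable_normalSpectralMeasure N x h.continuous).sub
      (integrable_indicator_one_normalSpectralMeasure N _ hS)).abs
  rw [h1, norm_cfc_apply_sq N x (by fun_prop), ← integral_add (hi f) (hi g)]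
  refine integral_mono (integrable_normalSpectralMeasure N x (by fun_prop))
    ((hi f).add (hi g)) fun z => ?_
  simp only [← Complex.ofReal_sub, Complex.norm_real, Real.norm_eq_abs, sq_abs]
  have h2 : |f z - g z| ≤ 1 := abs_le.mpr ⟨by linarith [(hf z).1, (hg z).2],
    by linarith [(hf z).2, (hg z).1]⟩
  calc (f z - g z) ^ 2 = |f z - g z| ^ 2 := (sq_abs _).symm
    _ ≤ |f z - g z| := by nlinarith [abs_nonneg (f z - g z)]
    _ ≤ |f z - S.indicator 1 z| + |S.indicator 1 z - g z| := abs_sub_le _ _ _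
    _ = _ := by rw [abs_sub_comm (S.indicator 1 z) (g z)]

/-- Quantitative strong approximation of a spectral projection by the continuous functional
calculus. -/
lemma norm_functionOf_sub_normalSpectralProjection_sq_le (N : H →L[ℂ] H) (x : H) {S : Set ℂ}
    (hS : MeasurableSet S) {f : C_c(ℂ, ℝ)} (hf : ∀ z, 0 ≤ f z ∧ f z ≤ 1) :
    ‖functionOf N f x - normalSpectralProjection N hS x‖ ^ 2 ≤
      ∫ z, |f z - S.indicator 1 z| ∂(normalSpectralMeasure N x) := by
  classical
  set P := normalSpectralProjection N hS
  set d := functionOf N f x - P x with hd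
  set e := ∫ z, |f z - S.indicator 1 z| ∂(normalSpectralMeasure N x) with he
  have he0 : 0 ≤ e := integral_nonneg fun z => abs_nonneg _
  -- a second approximation `g`, as good as desired, is compared with `f` in norm and with `P` weakly
  have key : ∀ ε : ℝ, 0 < ε → ‖d‖ ^ 2 ≤ ‖d‖ * √(e + ε) + ε := by
    intro ε hε
    -- `g(N)` approximates `P` in the four quadratic forms that determine `⟪P x, d⟫`
    obtain ⟨g, hg, hgε⟩ := exists_integral_abs_sub_indicator_le N hS
      {x, x + d, x - d, x + I • d, x - I • d} hε
    have hq : ∀ v ∈ ({x, x + d, x - d, x + I • d, x - I • d} : Finset H),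
        ‖⟪(functionOf N g - P) v, v⟫_ℂ‖ ≤ ε := by
      intro v hv
      have h2 := (functionOf_isPositive N g fun z => (hg z).1).inner_nonneg_right v
      have h3 : ⟪v, functionOf N g v⟫_ℂ = (((⟪v, functionOf N g v⟫_ℂ).re : ℝ) : ℂ) :=
        Complex.ext rfl (by simpa using (Complex.nonneg_iff.mp h2).2.symm)
      have h4 : (normalSpectralMeasure N v).real S =
          ∫ z, S.indicator 1 z ∂(normalSpectralMeasure N v) := by
        rw [integral_indicator_one hS]
      have hgi : Integrable (fun z => g z) (normalSpectralMeasure N v) :=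
        integrable_normalSpectralMeasure N v g.continuous
      rw [norm_inner_symm, sub_apply, inner_sub_right, inner_normalSpectralProjection, h3,
        ← integral_normalSpectralMeasure, ← Complex.ofReal_sub, Complex.norm_real, h4,
        ← integral_sub hgi (integrable_indicator_one_normalSpectralMeasure N v hS)]
      exact (norm_integral_le_integral_norm _).trans (hgε v hv)
    have hpol : ‖⟪(functionOf N g - P) x, d⟫_ℂ‖ ≤ ε := by
      have h := inner_map_polarization' ((functionOf N g - P : H →L[ℂ] H) : H →ₗ[ℂ] H) x d
      simp only [ContinuousLinearMap.coe_coe] at h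
      rw [h, norm_div]
      have h1 := hq (x + d) (by simp)
      have h2 := hq (x - d) (by simp)
      have h3 := hq (x + I • d) (by simp)
      have h4 := hq (x - I • d) (by simp)
      have : ∀ a b c d : ℂ, ‖a‖ ≤ ε → ‖b‖ ≤ ε → ‖c‖ ≤ ε → ‖d‖ ≤ ε →
          ‖a - b - I * c + I * d‖ / ‖(4 : ℂ)‖ ≤ ε := by
        intro a b c d ha hb hc hd
        have h5 : ‖a - b - I * c + I * d‖ ≤ ‖a‖ + ‖b‖ + ‖c‖ + ‖d‖ := by
          calc _ ≤ ‖a - b - I * c‖ + ‖I * d‖ := norm_add_le _ _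
            _ ≤ ‖a - b‖ + ‖I * c‖ + ‖I * d‖ := by gcongr; exact norm_sub_le _ _
            _ ≤ ‖a‖ + ‖b‖ + ‖I * c‖ + ‖I * d‖ := by gcongr; exact norm_sub_le _ _
            _ = _ := by simp
        have h6 : ‖(4 : ℂ)‖ = 4 := by norm_num
        rw [h6]; linarith
      exact this _ _ _ _ h1 h2 h3 h4
    have hfg : ‖functionOf N f x - functionOf N g x‖ ≤ √(e + ε) := by
      apply Real.le_sqrt_of_sq_le
      exact (norm_functionOf_sub_apply_sq_le N x hS hf hg).trans
        (by linarith [hgε x (by simp)])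
    have hdd : d = (functionOf N f x - functionOf N g x) + (functionOf N g - P) x := by
      rw [hd, sub_apply]; abel
    calc ‖d‖ ^ 2 = ‖⟪d, d⟫_ℂ‖ := by rw [inner_self_eq_norm_sq_to_K]; simp
      _ = ‖⟪functionOf N f x - functionOf N g x, d⟫_ℂ + ⟪(functionOf N g - P) x, d⟫_ℂ‖ := by
        rw [← inner_add_left, ← hdd]
      _ ≤ ‖functionOf N f x - functionOf N g x‖ * ‖d‖ + ε :=
        (norm_add_le _ _).trans (add_le_add (norm_inner_le_norm _ _) hpol)
      _ ≤ _ := by rw [mul_comm]; gcongr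
  have hlim : Tendsto (fun ε : ℝ => ‖d‖ * √(e + ε) + ε) (𝓝[>] 0) (𝓝 (‖d‖ * √(e + 0) + 0)) := by
    apply Tendsto.mono_left _ nhdsWithin_le_nhds
    exact Continuous.tendsto (by fun_prop) 0
  have h := ge_of_tendsto hlim (eventually_mem_nhdsWithin.mono fun ε hε => key ε hε)
  simp only [add_zero] at h
  have h2 := Real.sq_sqrt he0
  rcases (norm_nonneg d).eq_or_lt with h0 | h0
  · rw [← h0]; simpa using he0
  · have h3 : ‖d‖ ≤ √e := le_of_mul_le_mul_left (by rwa [← sq]) h0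
    calc ‖d‖ ^ 2 ≤ √e ^ 2 := by gcongr
      _ = e := h2

/-- The spectral projection is a strong limit, on finitely many vectors simultaneously, of continuous
functions of the operator. -/
lemma exists_tendsto_normalSpectralProjection (N : H →L[ℂ] H) {S : Set ℂ} (hS : MeasurableSet S)
    (F : Finset H) :
    ∃ f : ℕ → C_c(ℂ, ℝ), (∀ n z, 0 ≤ f n z ∧ f n z ≤ 1) ∧ ∀ v ∈ F,
      Tendsto (fun n => ∫ z, |f n z - S.indicator 1 z| ∂(normalSpectralMeasure N v)) atTop (𝓝 0) ∧
      Tendsto (fun n => functionOf N (f n) v) atTop (𝓝 (normalSpectralProjection N hS v)) := by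
  choose f hf hfε using fun n : ℕ => exists_integral_abs_sub_indicator_le N hS F
    (ε := 1 / ((n : ℝ) + 1)) (by positivity)
  refine ⟨f, hf, fun v hv => ?_⟩
  have h1 : Tendsto (fun n => ∫ z, |f n z - S.indicator 1 z| ∂(normalSpectralMeasure N v))
      atTop (𝓝 0) :=
    squeeze_zero (fun n => integral_nonneg fun z => abs_nonneg _) (fun n => hfε n v hv)
      tendsto_one_div_add_atTop_nhds_zero_nat
  refine ⟨h1, ?_⟩
  rw [tendsto_iff_norm_sub_tendsto_zero]
  have h2 : Tendsto (fun n => ‖functionOf N (f n) v - normalSpectralProjection N hS v‖ ^ 2)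
      atTop (𝓝 0) :=
    squeeze_zero (fun n => sq_nonneg _)
      (fun n => norm_functionOf_sub_normalSpectralProjection_sq_le N v hS (hf n)) h1
  simpa using h2.sqrt

lemma norm_normalSpectralProjection_sq (N : H →L[ℂ] H) {S : Set ℂ} (hS : MeasurableSet S) (x : H) :
    ‖normalSpectralProjection N hS x‖ ^ 2 = (normalSpectralMeasure N x).real S := by
  obtain ⟨f, hf, hlim⟩ := exists_tendsto_normalSpectralProjection N hS {x}
  obtain ⟨h1, h2⟩ := hlim x (by simp)
  refine tendsto_nhds_unique (h2.norm.pow 2) ?_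
  rw [tendsto_iff_norm_sub_tendsto_zero]
  refine squeeze_zero (fun n => norm_nonneg _) (fun n => ?_) (by simpa using h1.const_mul 2)
  have hfc := (f n).continuous
  have hi := integrable_indicator_one_normalSpectralMeasure N x hS
  rw [functionOf, norm_cfc_apply_sq N x (by fun_prop), ← integral_indicator_one hS,
    ← integral_sub (integrable_normalSpectralMeasure N x (by fun_prop)) hi, ← integral_const_mul]
  refine (norm_integral_le_integral_norm _).trans (integral_mono
    ((integrable_normalSpectralMeasure N x (by fun_prop)).sub hi).norm
    (((integrable_normalSpectralMeasure N x hfc).sub hi).abs.const_mul 2) fun z => ?_)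
  simp only [Complex.norm_real, Real.norm_eq_abs, sq_abs]
  -- `|f² - 1_S| = |f - 1_S| (f + 1_S)`
  have h3 : (S.indicator 1 z : ℝ) ^ 2 = S.indicator 1 z ∧ 0 ≤ (S.indicator 1 z : ℝ) ∧
      (S.indicator 1 z : ℝ) ≤ 1 := by
    by_cases hz : z ∈ S <;> simp [hz]
  obtain ⟨h3, h4, h5⟩ := h3
  have h6 : (f n z) ^ 2 - S.indicator 1 z =
      (f n z - S.indicator 1 z) * (f n z + S.indicator 1 z) := by
    linear_combination h3
  rw [h6, abs_mul, abs_of_nonneg (by linarith [(hf n z).1] : 0 ≤ f n z + S.indicator 1 z), mul_comm]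
  gcongr
  linarith [(hf n z).2]

/-- The identity `⟨x, P x⟩ = μ_x(S) = ‖P x‖²` says that `P = P* P`. -/
theorem isStarProjection_normalSpectralProjection (N : H →L[ℂ] H) {S : Set ℂ}
    (hS : MeasurableSet S) : IsStarProjection (normalSpectralProjection N hS) := by
  set P := normalSpectralProjection N hS
  have h : star P * P = P := by
    apply ContinuousLinearMap.coe_injective
    rw [← ext_inner_map]
    intro x
    rw [← inner_conj_symm, ← inner_conj_symm (((P : H →ₗ[ℂ] H)) x)]
    congr 1
    simp only [ContinuousLinearMap.coe_coe, ContinuousLinearMap.mul_def,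
      ContinuousLinearMap.comp_apply, ContinuousLinearMap.star_eq_adjoint]
    rw [ContinuousLinearMap.adjoint_inner_right, inner_normalSpectralProjection,
      ← norm_normalSpectralProjection_sq N hS, inner_self_eq_norm_sq_to_K]
    simp [P]
  have hs : star P = P := by
    conv_lhs => rw [← h]
    rw [star_mul, star_star, h]
  exact ⟨by rw [hs] at h; exact h, hs⟩

/-- A spectral projection of `N` commutes with every bounded operator that commutes with `N` and
its adjoint. -/
theorem commute_normalSpectralProjection (N : H →L[ℂ] H) {S : Set ℂ}
    (hS : MeasurableSet S) {T : H →L[ℂ] H} (hT : Commute N T) (hT' : Commute (star N) T) :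
    Commute (normalSpectralProjection N hS) T := by
  classical
  ext x
  obtain ⟨f, -, hlim⟩ := exists_tendsto_normalSpectralProjection N hS {x, T x}
  have h1 := (hlim (T x) (by simp)).2
  have h2 := (T.continuous.tendsto _).comp (hlim x (by simp)).2
  refine tendsto_nhds_unique h1 (h2.congr fun n => ?_)
  have h3 : Commute (cfc (fun z : ℂ => ((f n z : ℝ) : ℂ)) N) T := hT.cfc hT' _
  exact (congrArg (fun L : H →L[ℂ] H => L x) h3.eq).symm

lemma normalSpectralMeasure_compl_of_apply_eq_self (N : H →L[ℂ] H) [IsStarNormal N] {S : Set ℂ}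
    (hS : MeasurableSet S) {x : H} (hx : normalSpectralProjection N hS x = x) :
    normalSpectralMeasure N x Sᶜ = 0 := by
  rw [← measureReal_eq_zero_iff (measure_ne_top _ _), measureReal_compl hS,
    measureReal_univ_normalSpectralMeasure, ← norm_normalSpectralProjection_sq N hS, hx, sub_self]

lemma normalSpectralMeasure_eq_zero_of_apply_eq_zero (N : H →L[ℂ] H) {S : Set ℂ}
    (hS : MeasurableSet S) {x : H} (hx : normalSpectralProjection N hS x = 0) :
    normalSpectralMeasure N x S = 0 := by
  rw [← measureReal_eq_zero_iff (measure_ne_top _ _), ← norm_normalSpectralProjection_sq N hS, hx,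
    norm_zero]
  simp

/-! ### The Cayley transform of a self-adjoint operator -/

lemma isStarNormal_cayley {A : H →ₗ.[ℂ] H} (hA : IsSelfAdjoint A) : IsStarNormal (cayley A) := by
  obtain ⟨h1, h2⟩ := Unitary.mem_iff.mp (cayley_mem_unitary hA)
  exact ⟨h1.trans h2.symm⟩

lemma resolvent_neg_I_apply_mem {A : H →ₗ.[ℂ] H} (hA : IsSelfAdjoint A) (y : H) :
    ∃ hy : resolvent A (-I) y ∈ A.domain,
      A ⟨resolvent A (-I) y, hy⟩ + I • resolvent A (-I) y = y := by
  obtain ⟨hy, h⟩ := (isResolventAt_resolvent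
    (mem_resolventSet_of_im_ne_zero hA (z := -I) (by simp))).1 y
  exact ⟨hy, by rwa [neg_smul, sub_neg_eq_add] at h⟩

lemma resolvent_neg_I_apply {A : H →ₗ.[ℂ] H} (hA : IsSelfAdjoint A) (x : A.domain) :
    resolvent A (-I) (A x + I • (x : H)) = x := by
  have h := (isResolventAt_resolvent
    (mem_resolventSet_of_im_ne_zero hA (z := -I) (by simp))).2 x
  rwa [neg_smul, sub_neg_eq_add] at h

lemma cayley_apply_add_I_smul {A : H →ₗ.[ℂ] H} (hA : IsSelfAdjoint A) (x : A.domain) :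
    cayley A (A x + I • (x : H)) = A x - I • (x : H) := by
  simp only [cayley, sub_apply, one_apply_eq_self, smul_apply, resolvent_neg_I_apply hA]
  module

lemma cayley_sub_cayleyMap_smul_apply {A : H →ₗ.[ℂ] H} (hA : IsSelfAdjoint A) (t : ℝ)
    (x : A.domain) :
    cayley A (A x + I • (x : H)) - cayleyMap t • (A x + I • (x : H)) =
      (2 * I / ((t : ℂ) + I)) • (A x - (t : ℂ) • (x : H)) := by
  have h := ofReal_add_I_ne_zero t
  rw [cayley_apply_add_I_smul hA, cayleyMap]
  match_scalars <;> field_simp <;> ring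

/-- If `t` is in the resolvent set, then `cayley A - cayleyMap t = 2i / (t + i) (A - t) (A + i)⁻¹` is
invertible. -/
lemma mem_realSpectrum_of_cayleyMap_mem_spectrum {A : H →ₗ.[ℂ] H} (hA : IsSelfAdjoint A) {t : ℝ}
    (ht : cayleyMap t ∈ spectrum ℂ (cayley A)) : t ∈ realSpectrum A := by
  intro hres
  obtain ⟨h1, h2⟩ := isResolventAt_resolvent hres
  set S := resolvent A t
  have hc := ofReal_add_I_ne_zero t
  have hc' : 2 * I / ((t : ℂ) + I) ≠ 0 := div_ne_zero (by simp) hc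
  rw [spectrum.mem_iff, IsUnit.sub_iff, isUnit_iff_exists] at ht
  refine ht ⟨(2 * I / ((t : ℂ) + I))⁻¹ • (1 + ((t : ℂ) + I) • S), ?_, ?_⟩
  · ext y
    obtain ⟨hy, hy2⟩ := h1 y
    have h := cayley_sub_cayleyMap_smul_apply hA t ⟨S y, hy⟩
    have h3 : y + ((t : ℂ) + I) • S y = A ⟨S y, hy⟩ + I • S y := by
      conv_lhs => enter [1]; rw [← hy2]
      module
    simp only at h
    rw [hy2] at h
    simp only [ContinuousLinearMap.mul_def, ContinuousLinearMap.comp_apply, sub_apply, smul_apply,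
      add_apply, one_apply_eq_self, Algebra.algebraMap_eq_smul_one, map_smul]
    rw [h3, h, smul_smul, inv_mul_cancel₀ hc', one_smul]
  · ext y
    obtain ⟨hy, hy2⟩ := resolvent_neg_I_apply_mem hA y
    have h := cayley_sub_cayleyMap_smul_apply hA t ⟨_, hy⟩
    have h3 := h2 ⟨_, hy⟩
    simp only at h h3
    rw [hy2] at h
    simp only [ContinuousLinearMap.mul_def, ContinuousLinearMap.comp_apply, sub_apply, smul_apply,
      add_apply, one_apply_eq_self, Algebra.algebraMap_eq_smul_one, h, map_smul, h3]
    rw [smul_smul, mul_inv_cancel₀ hc', one_smul]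
    conv_rhs => rw [← hy2]
    module

lemma eq_one_or_eq_cayleyMap_of_mem_spectrum {A : H →ₗ.[ℂ] H} (hA : IsSelfAdjoint A) {z : ℂ}
    (hz : z ∈ spectrum ℂ (cayley A)) : z = 1 ∨ ∃ t ∈ realSpectrum A, cayleyMap t = z := by
  have h0 : ‖z‖ = 1 := by
    have hU := cayley_mem_unitary hA
    -- the definition of `cayley A` is hidden from unification
    generalize cayley A = U at hU hz
    exact spectrum.norm_eq_one_of_unitary hU hz
  by_cases h1 : z = 1
  · exact Or.inl h1
  obtain ⟨t, rfl⟩ := exists_cayleyMap_eq h0 h1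
  exact Or.inr ⟨t, mem_realSpectrum_of_cayleyMap_mem_spectrum hA hz, rfl⟩

lemma inner_eq_zero_of_mem_eigenspace {A : H →ₗ.[ℂ] H} (hA : IsSelfAdjoint A) {s t : ℝ}
    (hst : s ≠ t) {x y : H} (hx : x ∈ eigenspace A s) (hy : y ∈ eigenspace A t) :
    ⟪x, y⟫_ℂ = 0 := by
  obtain ⟨hx1, hx2⟩ := mem_eigenspace.mp hx
  obtain ⟨hy1, hy2⟩ := mem_eigenspace.mp hy
  have h := inner_symm_of_isSelfAdjoint hA ⟨x, hx1⟩ ⟨y, hy1⟩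
  rw [hx2, hy2, inner_smul_left, inner_smul_right, Complex.conj_ofReal] at h
  have h2 : ((s : ℂ) - t) * ⟪x, y⟫_ℂ = 0 := by rw [sub_mul, h, sub_self]
  refine (mul_eq_zero.mp h2).resolve_left (sub_ne_zero.mpr ?_)
  exact_mod_cast hst

/-- The eigenspaces of `A` are those of the bounded operator `cayley A`. -/
lemma mem_eigenspace_iff_cayley {A : H →ₗ.[ℂ] H} (hA : IsSelfAdjoint A) {t : ℝ} {x : H} :
    x ∈ eigenspace A t ↔ cayley A x = cayleyMap t • x := by
  have hc := ofReal_add_I_ne_zero t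
  rw [mem_eigenspace]
  constructor
  · rintro ⟨hx, h⟩
    have h2 := cayley_apply_add_I_smul hA ⟨x, hx⟩
    rw [h, ← add_smul, map_smul] at h2
    have h3 : x = ((t : ℂ) + I)⁻¹ • ((t : ℂ) + I) • x := by
      rw [smul_smul, inv_mul_cancel₀ hc, one_smul]
    conv_lhs => rw [h3]
    rw [map_smul, map_smul, h2, cayleyMap]
    match_scalars
    field_simp
  · intro h
    have hR : resolvent A (-I) x = ((t : ℂ) + I)⁻¹ • x := by
      rw [resolvent_neg_I_eq, smul_apply, sub_apply, one_apply_eq_self, h]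
      have h1 : x - cayleyMap t • x = (1 - cayleyMap t) • x := by module
      rw [h1, one_sub_cayleyMap, smul_smul]
      congr 1
      field_simp
    obtain ⟨hy, hy2⟩ := resolvent_neg_I_apply_mem hA x
    have hx : x = ((t : ℂ) + I) • resolvent A (-I) x := by
      rw [hR, smul_smul, mul_inv_cancel₀ hc, one_smul]
    have hxD : x ∈ A.domain := by rw [hx]; exact A.domain.smul_mem _ hy
    refine ⟨hxD, ?_⟩
    have h4 : (⟨x, hxD⟩ : A.domain) = ((t : ℂ) + I) • ⟨_, hy⟩ := Subtype.ext hx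
    rw [h4, A.map_smul, eq_sub_of_add_eq hy2, smul_sub, smul_comm _ I, ← hx, ← sub_smul,
      add_sub_cancel_right]

lemma isClosed_eigenspace {A : H →ₗ.[ℂ] H} (hA : IsSelfAdjoint A) (t : ℝ) :
    _root_.IsClosed (eigenspace A t : Set H) := by
  have h : (eigenspace A t : Set H) = {x | cayley A x = cayleyMap t • x} :=
    Set.ext fun x => mem_eigenspace_iff_cayley hA
  rw [h]
  exact isClosed_eq (by fun_prop) (by fun_prop)

lemma countable_eigenvalues [TopologicalSpace.SeparableSpace H] {A : H →ₗ.[ℂ] H}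
    (hA : IsSelfAdjoint A) : (eigenvalues A).Countable := by
  have h : ∀ t : eigenvalues A, ∃ x ∈ eigenspace A t, ‖x‖ = 1 := by
    rintro ⟨t, x, hx, hAx⟩
    exact ⟨(‖(x : H)‖⁻¹ : ℂ) • (x : H),
      (eigenspace A t).smul_mem _ (mem_eigenspace.mpr ⟨x.2, hAx⟩), norm_smul_inv_norm hx⟩
  choose e he he1 using h
  -- the balls of radius `1/2` around unit eigenvectors of different eigenvalues are disjoint
  have hdis : (Set.univ : Set (eigenvalues A)).PairwiseDisjoint
      fun t => Metric.ball (e t) (1 / 2) := by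
    intro s _ t _ hst
    apply Metric.ball_disjoint_ball
    have h0 : ⟪e s, e t⟫_ℂ = 0 :=
      inner_eq_zero_of_mem_eigenspace hA (fun h => hst (Subtype.ext h)) (he s) (he t)
    have h1 : ‖e s - e t‖ ^ 2 = 2 := by
      rw [@norm_sub_sq ℂ, h0, he1, he1]; norm_num
    rw [dist_eq_norm]
    nlinarith [norm_nonneg (e s - e t)]
  have := hdis.countable_of_isOpen (fun _ _ => Metric.isOpen_ball)
    fun t _ => ⟨e t, Metric.mem_ball_self (by norm_num)⟩
  exact Set.countable_coe_iff.mp (Set.countable_univ_iff.mp this)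

lemma normalSpectralProjection_singleton_mem_eigenspace {A : H →ₗ.[ℂ] H} (hA : IsSelfAdjoint A)
    (t : ℝ) (x : H) :
    normalSpectralProjection (cayley A) (measurableSet_singleton (cayleyMap t)) x ∈
      eigenspace A t := by
  have hN := isStarNormal_cayley hA
  set P := normalSpectralProjection (cayley A) (measurableSet_singleton (cayleyMap t))
  have hP : P * P = P := (isStarProjection_normalSpectralProjection (cayley A) _).1
  have hPx : P (P x) = P x := congrArg (fun L : H →L[ℂ] H => L x) hP
  have h0 := normalSpectralMeasure_compl_of_apply_eq_self (cayley A) _ hPx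
  rw [mem_eigenspace_iff_cayley hA, ← sub_eq_zero, ← norm_eq_zero, ← sq_eq_zero_iff,
    norm_apply_sub_smul_sq]
  refine integral_eq_zero_of_ae ?_
  have h3 : ∀ᵐ z ∂(normalSpectralMeasure (cayley A) (P x)), z ∈ ({cayleyMap t} : Set ℂ) := h0
  filter_upwards [h3] with z hz
  rw [Set.mem_singleton_iff.mp hz]
  simp

/-! ### Spectral projections of an unbounded self-adjoint operator -/

lemma isStarProjection_spectralProjection (A : H →ₗ.[ℂ] H) {Ω : Set ℝ} (hΩ : MeasurableSet Ω) :
    IsStarProjection (spectralProjection A hΩ) :=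
  isStarProjection_normalSpectralProjection _ _

lemma spectralProjection_idem (A : H →ₗ.[ℂ] H) {Ω : Set ℝ} (hΩ : MeasurableSet Ω) (x : H) :
    spectralProjection A hΩ (spectralProjection A hΩ x) = spectralProjection A hΩ x :=
  congrArg (fun L : H →L[ℂ] H => L x) (isStarProjection_spectralProjection A hΩ).1

lemma inner_spectralProjection_left (A : H →ₗ.[ℂ] H) {Ω : Set ℝ} (hΩ : MeasurableSet Ω) (x y : H) :
    ⟪spectralProjection A hΩ x, y⟫_ℂ = ⟪x, spectralProjection A hΩ y⟫_ℂ := by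
  have h := (isStarProjection_spectralProjection A hΩ).2.star_eq
  rw [ContinuousLinearMap.star_eq_adjoint] at h
  conv_rhs => rw [← h]
  rw [ContinuousLinearMap.adjoint_inner_right]

lemma commute_spectralProjection_cayley {A : H →ₗ.[ℂ] H} (hA : IsSelfAdjoint A) {Ω : Set ℝ}
    (hΩ : MeasurableSet Ω) : Commute (spectralProjection A hΩ) (cayley A) :=
  commute_normalSpectralProjection _ _ (Commute.refl _) (isStarNormal_cayley hA).star_comm_self

lemma commute_spectralProjection_resolvent {A : H →ₗ.[ℂ] H} (hA : IsSelfAdjoint A) {Ω : Set ℝ}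
    (hΩ : MeasurableSet Ω) : Commute (spectralProjection A hΩ) (resolvent A (-I)) := by
  rw [resolvent_neg_I_eq]
  exact ((Commute.one_right _).sub_right (commute_spectralProjection_cayley hA hΩ)).smul_right _

lemma cfc_cayley_eq_resolvent {A : H →ₗ.[ℂ] H} (hA : IsSelfAdjoint A) :
    cfc (fun z : ℂ => (2 * I)⁻¹ * (1 - z)) (cayley A) = resolvent A (-I) := by
  have hN := isStarNormal_cayley hA
  rw [cfc_const_mul _ _ _ (by fun_prop), cfc_sub (fun _ : ℂ => 1) (fun z : ℂ => z) (cayley A)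
    (by fun_prop) (by fun_prop), cfc_const_one ℂ (cayley A), cfc_id' ℂ (cayley A),
    resolvent_neg_I_eq]

/-- An inequality between the values of two continuous functions at the points of `σ(A) \ Ω` passes
to the functional calculus on the kernel of `χ_Ω(A)`. The value at the point `1` of the unit circle
corresponds to the point at infinity of `ℝ`. -/
lemma norm_cfc_cayley_apply_le {A : H →ₗ.[ℂ] H} (hA : IsSelfAdjoint A) {Ω : Set ℝ}
    (hΩ : MeasurableSet Ω) {f g : ℂ → ℂ} (hf : Continuous f) (hg : Continuous g)
    (h1 : ‖f 1‖ ≤ ‖g 1‖) (h : ∀ t ∈ realSpectrum A \ Ω, ‖f (cayleyMap t)‖ ≤ ‖g (cayleyMap t)‖)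
    {x : H} (hx : spectralProjection A hΩ x = 0) :
    ‖cfc f (cayley A) x‖ ≤ ‖cfc g (cayley A) x‖ := by
  rw [← sq_le_sq₀ (norm_nonneg _) (norm_nonneg _), norm_cfc_apply_sq _ _ hf,
    norm_cfc_apply_sq _ _ hg]
  have h0 : ∀ᵐ z ∂(normalSpectralMeasure (cayley A) x), z ∉ cayleyMap '' Ω :=
    measure_eq_zero_iff_ae_notMem.mp
      (normalSpectralMeasure_eq_zero_of_apply_eq_zero (cayley A) _ hx)
  refine integral_mono_ae (integrable_normalSpectralMeasure _ _ (by fun_prop))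
    (integrable_normalSpectralMeasure _ _ (by fun_prop)) ?_
  filter_upwards [h0, ae_mem_spectrum (cayley A) x] with z hz hz'
  rcases eq_one_or_eq_cayleyMap_of_mem_spectrum hA hz' with rfl | ⟨t, ht, rfl⟩
  · gcongr
  · have := h t ⟨ht, fun htΩ => hz ⟨t, htΩ, rfl⟩⟩
    gcongr

/-- If `s` has distance at least `δ` from `σ(A) \ Ω`, then `A - s` is bounded below by `δ` on the
kernel of `χ_Ω(A)`. -/
theorem mul_norm_sub_spectralProjection_le {A : H →ₗ.[ℂ] H} (hA : IsSelfAdjoint A) {Ω : Set ℝ}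
    (hΩ : MeasurableSet Ω) {s δ : ℝ} (hδ : 0 ≤ δ) (h : ∀ t ∈ realSpectrum A \ Ω, δ ≤ dist s t)
    (x : A.domain) :
    δ * ‖(x : H) - spectralProjection A hΩ x‖ ≤ ‖A x - (s : ℂ) • (x : H)‖ := by
  have hN := isStarNormal_cayley hA
  set Q := spectralProjection A hΩ
  set R := resolvent A (-I)
  -- with `w = (A + i) x`, both sides are values of functions of the Cayley transform at `w - Q w`
  set w := A x + I • (x : H) with hw
  have hRw : R w = x := resolvent_neg_I_apply hA x
  have hQR : ∀ y, Q (R y) = R (Q y) := fun y =>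
    congrArg (fun L : H →L[ℂ] H => L y) (commute_spectralProjection_resolvent hA hΩ).eq
  have hQ0 : Q (w - Q w) = 0 := by rw [map_sub, spectralProjection_idem, sub_self]
  have hle := norm_cfc_cayley_apply_le hA hΩ
    (f := fun z => (δ : ℂ) * ((2 * I)⁻¹ * (1 - z)))
    (g := fun z => 1 - ((s : ℂ) + I) * ((2 * I)⁻¹ * (1 - z))) (by fun_prop) (by fun_prop)
    (by simp) (fun t ht => by
      have hc := ofReal_add_I_ne_zero t
      have h1 : (2 * I)⁻¹ * (2 * I / ((t : ℂ) + I)) = 1 / ((t : ℂ) + I) := by field_simp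
      have h2 : 1 - ((s : ℂ) + I) * (1 / ((t : ℂ) + I)) = -(((s : ℂ) - t) * (1 / ((t : ℂ) + I))) := by
        field_simp; ring
      rw [one_sub_cayleyMap, h1, h2, norm_neg, norm_mul, norm_mul, ← Complex.ofReal_sub,
        Complex.norm_real, Complex.norm_real, Real.norm_of_nonneg hδ]
      exact mul_le_mul_of_nonneg_right (h t ht) (norm_nonneg _)) hQ0
  rw [cfc_const_mul _ _ _ (by fun_prop), cfc_sub (fun _ : ℂ => 1) _ (cayley A) (by fun_prop)
    (by fun_prop), cfc_const_mul ((s : ℂ) + I) _ _ (by fun_prop), cfc_cayley_eq_resolvent hA,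
    cfc_const_one ℂ (cayley A)] at hle
  simp only [sub_apply, smul_apply, one_apply_eq_self, norm_smul, Complex.norm_real,
    Real.norm_of_nonneg hδ] at hle
  have h3 : R (w - Q w) = x - Q x := by rw [map_sub, ← hQR, hRw]
  have h4 : w - Q w - ((s : ℂ) + I) • (x - Q x : H) =
      (1 - Q) (A x - (s : ℂ) • (x : H)) := by
    rw [hw]
    simp only [sub_apply, one_apply_eq_self, map_add, map_sub, map_smul]
    module
  change δ * ‖R (w - Q w)‖ ≤ ‖w - Q w - ((s : ℂ) + I) • R (w - Q w)‖ at hle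
  rw [h3, h4] at hle
  refine hle.trans (((1 - Q).le_opNorm _).trans (mul_le_of_le_one_left (norm_nonneg _) ?_))
  exact IsStarProjection.norm_le _ (isStarProjection_spectralProjection A hΩ).one_sub

/-- If `Ω` is bounded, then `χ_Ω(A)` maps into the domain of `A`: the function `z ↦ 2i / (1 - z)`,
which takes the value `t + i` at the Cayley transform of `t`, agrees on the image of `Ω` with a
continuous function `f`, so that `χ_Ω(A) = (A + i)⁻¹ f(U) χ_Ω(A)` for the Cayley transform `U`
of `A`. -/
theorem spectralProjection_apply_mem_domain {A : H →ₗ.[ℂ] H} (hA : IsSelfAdjoint A) {Ω : Set ℝ}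
    (hΩ : MeasurableSet Ω) (hΩb : Bornology.IsBounded Ω) (x : H) :
    spectralProjection A hΩ x ∈ A.domain := by
  have hN := isStarNormal_cayley hA
  obtain ⟨M, hM⟩ := hΩb.exists_norm_le
  set y := spectralProjection A hΩ x with hy
  have hy0 : normalSpectralMeasure (cayley A) y (cayleyMap '' Ω)ᶜ = 0 :=
    normalSpectralMeasure_compl_of_apply_eq_self (cayley A) _ (spectralProjection_idem A hΩ x)
  -- `|1 - z|² = 4 / (t² + 1) ≥ ρ` at the Cayley transform `z` of `t ∈ Ω`
  let ρ : ℝ := 4 / (M ^ 2 + 1)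
  have hρ : 0 < ρ := by positivity
  let f : ℂ → ℂ := fun z => (2 * I) * (star (1 - z) / ((max (‖1 - z‖ ^ 2) ρ : ℝ) : ℂ))
  have hmax : ∀ z : ℂ, ((max (‖1 - z‖ ^ 2) ρ : ℝ) : ℂ) ≠ 0 := fun z => by
    exact_mod_cast (hρ.trans_le (le_max_right _ _)).ne'
  have hf : Continuous f := by
    refine continuous_const.mul (Continuous.div (by fun_prop) ?_ hmax)
    exact Complex.continuous_ofReal.comp (by fun_prop)
  have hfc : ∀ t ∈ Ω, (2 * I)⁻¹ * (1 - cayleyMap t) * f (cayleyMap t) = 1 := by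
    intro t ht
    have hc := ofReal_add_I_ne_zero t
    have h1 : ‖1 - cayleyMap t‖ ^ 2 = 4 / (t ^ 2 + 1) := by
      rw [one_sub_cayleyMap, norm_div, div_pow, Complex.sq_norm, Complex.sq_norm,
        Complex.normSq_apply, Complex.normSq_apply]
      simp only [Complex.mul_re, Complex.mul_im, Complex.add_re, Complex.add_im,
        Complex.ofReal_re, Complex.ofReal_im, Complex.I_re, Complex.I_im, Complex.re_ofNat,
        Complex.im_ofNat]
      congr 1 <;> ring
    have h2 : ρ ≤ ‖1 - cayleyMap t‖ ^ 2 := by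
      rw [h1]
      have h3 : |t| ≤ M := hM t ht
      have h4 : t ^ 2 ≤ M ^ 2 := sq_le_sq' (by linarith [neg_le_of_abs_le h3]) (le_of_abs_le h3)
      simp only [ρ]
      gcongr
    have h5 := hmax (cayleyMap t)
    simp only [f]
    rw [max_eq_left h2] at h5 ⊢
    have h6 : (1 - cayleyMap t) * star (1 - cayleyMap t) = ((‖1 - cayleyMap t‖ ^ 2 : ℝ) : ℂ) := by
      rw [Complex.star_def, Complex.mul_conj']; push_cast; rfl
    calc _ = (2 * I)⁻¹ * (2 * I) * ((1 - cayleyMap t) * star (1 - cayleyMap t)) /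
          ((‖1 - cayleyMap t‖ ^ 2 : ℝ) : ℂ) := by ring
      _ = 1 := by rw [h6, inv_mul_cancel₀ (by simp), one_mul, div_self h5]
  have h1 : cfc (fun z : ℂ => (2 * I)⁻¹ * (1 - z) * f z - 1) (cayley A) y = 0 := by
    rw [← norm_eq_zero, ← sq_eq_zero_iff, norm_cfc_apply_sq _ _ (by fun_prop)]
    refine integral_eq_zero_of_ae ?_
    have h2 : ∀ᵐ z ∂(normalSpectralMeasure (cayley A) y), z ∈ cayleyMap '' Ω := hy0
    filter_upwards [h2] with z hz
    obtain ⟨t, ht, rfl⟩ := hz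
    rw [hfc t ht]
    simp
  rw [cfc_sub (fun z : ℂ => (2 * I)⁻¹ * (1 - z) * f z) (fun _ => 1) (cayley A) (by fun_prop)
    (by fun_prop), cfc_mul (fun z : ℂ => (2 * I)⁻¹ * (1 - z)) f (cayley A) (by fun_prop)
    (by fun_prop), cfc_const_one ℂ (cayley A), cfc_cayley_eq_resolvent hA] at h1
  have h2 : resolvent A (-I) (cfc f (cayley A) y) = y := sub_eq_zero.mp h1
  rw [← h2]
  exact (resolvent_neg_I_apply_mem hA _).1

/-- If `A` has only point spectrum in `Ω`, then the range of `χ_Ω(A)` contains no vector orthogonal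
to all eigenvectors. -/
theorem eq_zero_of_forall_eigenspace_inner_eq_zero [TopologicalSpace.SeparableSpace H]
    {A : H →ₗ.[ℂ] H} (hA : IsSelfAdjoint A) {Ω : Set ℝ} (hΩ : MeasurableSet Ω)
    (hp : HasOnlyPointSpectrumIn A Ω) {x : H} (hx : spectralProjection A hΩ x = x)
    (h : ∀ t ∈ Ω, ∀ e ∈ eigenspace A t, ⟪x, e⟫_ℂ = 0) : x = 0 := by
  have hN := isStarNormal_cayley hA
  set μ := normalSpectralMeasure (cayley A) x
  have h1 : μ (cayleyMap '' Ω)ᶜ = 0 := normalSpectralMeasure_compl_of_apply_eq_self (cayley A) _ hx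
  have h2 : μ (cayleyMap '' (Ω \ eigenvalues A)) = 0 := by
    have := hp x
    rwa [spectralMeasure, measurableEmbedding_cayleyMap.comap_apply] at this
  have h3 : μ (cayleyMap '' (Ω ∩ eigenvalues A)) = 0 := by
    rw [← Set.biUnion_of_singleton (cayleyMap '' (Ω ∩ eigenvalues A))]
    rw [measure_biUnion_null_iff (((countable_eigenvalues hA).mono Set.inter_subset_right).image _)]
    rintro _ ⟨t, ⟨htΩ, -⟩, rfl⟩
    rw [← measureReal_eq_zero_iff (measure_ne_top _ _)]
    have h4 := inner_normalSpectralProjection (cayley A) (measurableSet_singleton (cayleyMap t)) x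
    rw [h t htΩ _ (normalSpectralProjection_singleton_mem_eigenspace hA t x)] at h4
    exact_mod_cast h4.symm
  -- the whole measure vanishes, and its total mass is `‖x‖²`
  have h5 : μ Set.univ = 0 := by
    rw [← Set.compl_union_self (cayleyMap '' Ω), measure_union_null_iff]
    refine ⟨h1, ?_⟩
    rw [← Set.sdiff_union_inter Ω (eigenvalues A), Set.image_union, measure_union_null_iff]
    exact ⟨h2, h3⟩
  have h6 := measureReal_univ_normalSpectralMeasure (cayley A) x
  rw [Measure.real, h5] at h6
  simpa using h6.symm

/-- The spectral measure of an eigenvector is concentrated at the eigenvalue. -/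
lemma spectralProjection_apply_of_mem_eigenspace {A : H →ₗ.[ℂ] H} (hA : IsSelfAdjoint A) {Ω : Set ℝ}
    (hΩ : MeasurableSet Ω) {t : ℝ} (ht : t ∈ Ω) {e : H} (he : e ∈ eigenspace A t) :
    spectralProjection A hΩ e = e := by
  have hN := isStarNormal_cayley hA
  have h0 : ∫ z, ‖z - cayleyMap t‖ ^ 2 ∂(normalSpectralMeasure (cayley A) e) = 0 := by
    rw [← norm_apply_sub_smul_sq, (mem_eigenspace_iff_cayley hA).mp he, sub_self]
    simp
  have hi : Integrable (fun z => ‖z - cayleyMap t‖ ^ 2) (normalSpectralMeasure (cayley A) e) :=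
    integrable_normalSpectralMeasure _ _ (by fun_prop)
  rw [integral_eq_zero_iff_of_nonneg (fun z => sq_nonneg _) hi] at h0
  have h1 : (normalSpectralMeasure (cayley A) e).real (cayleyMap '' Ω) = ‖e‖ ^ 2 := by
    rw [← measureReal_univ_normalSpectralMeasure (cayley A)]
    refine measureReal_congr (Filter.eventuallyEq_set.mpr ?_)
    filter_upwards [h0] with z hz
    have hz' : z = cayleyMap t := by simpa [sub_eq_zero] using hz
    simp only [Set.mem_univ, iff_true, hz']
    exact ⟨t, ht, rfl⟩
  have h2 : ‖spectralProjection A hΩ e‖ ^ 2 = ‖e‖ ^ 2 :=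
    (norm_normalSpectralProjection_sq (cayley A) _ e).trans h1
  have h3 : ⟪e, spectralProjection A hΩ e⟫_ℂ = ((‖e‖ ^ 2 : ℝ) : ℂ) :=
    (inner_normalSpectralProjection (cayley A) _ e).trans (by rw [h1])
  rw [eq_comm, ← sub_eq_zero, ← norm_eq_zero, ← sq_eq_zero_iff, @norm_sub_sq ℂ, h2, h3]
  simp only [RCLike.re_to_complex, Complex.ofReal_re]
  ring

/-! ### Bases of eigenvectors -/

/-- If `A` has only point spectrum in `Ω`, then there is a Hilbert basis each element of which is
either annihilated by `χ_Ω(A)` or an eigenvector of `A` for an eigenvalue in `Ω`. -/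
theorem exists_hilbertBasis_eigenspace.{u} {H : Type u} [NormedAddCommGroup H]
    [InnerProductSpace ℂ H] [CompleteSpace H] [TopologicalSpace.SeparableSpace H]
    {A : H →ₗ.[ℂ] H} (hA : IsSelfAdjoint A) {Ω : Set ℝ} (hΩ : MeasurableSet Ω)
    (hp : HasOnlyPointSpectrumIn A Ω) :
    ∃ (ι : Type u) (b : HilbertBasis ι ℂ H), ∀ i, spectralProjection A hΩ (b i) = 0 ∨
      ∃ t ∈ Ω, b i ∈ eigenspace A t := by
  set P := spectralProjection A hΩ
  -- `none` stands for the kernel of `χ_Ω(A)`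
  let G : Option Ω → Submodule ℂ H := fun o =>
    o.elim (LinearMap.ker (P : H →ₗ[ℂ] H)) fun t => eigenspace A t
  have hPe : ∀ (t : Ω) (e : H), e ∈ eigenspace A t → P e = e := fun t e he =>
    spectralProjection_apply_of_mem_eigenspace hA hΩ t.2 he
  have hker : ∀ x ∈ LinearMap.ker (P : H →ₗ[ℂ] H), ∀ (t : Ω), ∀ e ∈ eigenspace A t,
      ⟪x, e⟫_ℂ = 0 := by
    intro x hx t e he
    rw [← hPe t e he, ← inner_spectralProjection_left, show P x = 0 from hx, inner_zero_left]
  have hG : OrthogonalFamily ℂ (fun o => G o) fun o => (G o).subtypeₗᵢ := by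
    rintro (_ | s) (_ | t) hst ⟨x, hx⟩ ⟨y, hy⟩
    · exact absurd rfl hst
    · exact hker x hx t y hy
    · exact inner_eq_zero_symm.mp (hker y hy s x hx)
    · exact inner_eq_zero_of_mem_eigenspace hA
        (fun h => hst (congrArg some (Subtype.ext h))) hx hy
  have hcl : ∀ o, _root_.IsClosed (G o : Set H) := by
    rintro (_ | t)
    · exact (P : H →L[ℂ] H).isClosed_ker
    · exact isClosed_eigenspace hA t
  have : ∀ o, CompleteSpace (G o) := fun o => (hcl o).completeSpace_coe
  choose w b hb using fun o => exists_hilbertBasis ℂ (G o)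
  have hon := hG.orthonormal_sigma_orthonormal (fun o => (b o).orthonormal)
  have hperp : ∀ x : H, (∀ o, ∀ i, ⟪((b o i : G o) : H), x⟫_ℂ = 0) →
      ∀ o, ∀ y ∈ G o, ⟪y, x⟫_ℂ = 0 := by
    intro x hx o y hy
    have h1 : (⟨y, hy⟩ : G o) ∈ (Submodule.span ℂ (Set.range (b o))).topologicalClosure := by
      rw [(b o).dense_span]; trivial
    have h2 : (Submodule.span ℂ (Set.range (b o))).topologicalClosure ≤
        LinearMap.ker (((innerSL ℂ x) ∘L (G o).subtypeL : G o →L[ℂ] ℂ) : G o →ₗ[ℂ] ℂ) := by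
      refine Submodule.topologicalClosure_minimal _ (Submodule.span_le.mpr ?_)
        (ContinuousLinearMap.isClosed_ker _)
      rintro _ ⟨i, rfl⟩
      exact inner_eq_zero_symm.mp (hx o i)
    exact inner_eq_zero_symm.mp (h2 h1)
  refine ⟨_, HilbertBasis.mkOfOrthogonalEqBot hon ?_, ?_⟩
  · rw [Submodule.eq_bot_iff]
    intro x hx
    rw [Submodule.mem_orthogonal] at hx
    have h1 := hperp x fun o i => hx _ (Submodule.subset_span ⟨⟨o, i⟩, rfl⟩)
    have h2 : P x = x := by
      have h3 : x - P x ∈ G none := by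
        change P (x - P x) = 0
        rw [map_sub, spectralProjection_idem, sub_self]
      have h4 : ⟪x - P x, x⟫_ℂ = 0 := h1 none _ h3
      have h5 : ⟪x - P x, P x⟫_ℂ = 0 := by
        rw [← inner_spectralProjection_left, map_sub, spectralProjection_idem, sub_self,
          inner_zero_left]
      have h6 : ⟪x - P x, x - P x⟫_ℂ = 0 := by rw [inner_sub_right, h4, h5, sub_zero]
      exact (sub_eq_zero.mp (inner_self_eq_zero.mp h6)).symm
    exact eq_zero_of_forall_eigenspace_inner_eq_zero hA hΩ hp h2 fun t ht e he =>
      inner_eq_zero_symm.mp (h1 (some ⟨t, ht⟩) e he)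
  · intro i
    rw [HilbertBasis.coe_mkOfOrthogonalEqBot]
    obtain ⟨_ | t, i⟩ := i
    · exact Or.inl (b none i).2
    · exact Or.inr ⟨t, t.2, (b (some t) i).2⟩

/-! ### Hilbert–Schmidt norms -/

lemma hilbertSchmidtNorm_sq {ι : Type*} (b : HilbertBasis ι ℂ H) (T : H →L[ℂ] H) :
    hilbertSchmidtNorm (T : H →ₗ[ℂ] H) ^ 2 = ∑' i, ‖T (b i)‖ₑ ^ 2 := by
  rw [hilbertSchmidtNorm_eq b, ← ENNReal.rpow_natCast, ← ENNReal.rpow_mul]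
  norm_num

lemma hilbertSchmidtNorm_adjoint (T : H →L[ℂ] H) :
    hilbertSchmidtNorm ((star T : H →L[ℂ] H) : H →ₗ[ℂ] H) =
      hilbertSchmidtNorm (T : H →ₗ[ℂ] H) := by
  obtain ⟨w, b, -⟩ := exists_hilbertBasis ℂ H
  rw [hilbertSchmidtNorm_eq b, hilbertSchmidtNorm_eq b, tsum_enorm_sq_eq_adjoint b b T]
  rfl

/-- The difference of two projections is the difference `P (1 - Q) - (1 - P) Q` of operators with
orthogonal ranges. -/
lemma hilbertSchmidtNorm_sub_sq {P Q : H →L[ℂ] H} (hP : IsStarProjection P)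
    (hQ : IsStarProjection Q) :
    hilbertSchmidtNorm ((P - Q : H →L[ℂ] H) : H →ₗ[ℂ] H) ^ 2 =
      hilbertSchmidtNorm (((1 - Q) * P : H →L[ℂ] H) : H →ₗ[ℂ] H) ^ 2 +
      hilbertSchmidtNorm (((1 - P) * Q : H →L[ℂ] H) : H →ₗ[ℂ] H) ^ 2 := by
  have h1 : star ((1 - Q) * P) = P * (1 - Q) := by
    rw [star_mul, hP.2.star_eq, hQ.one_sub.2.star_eq]
  rw [← hilbertSchmidtNorm_adjoint ((1 - Q) * P), h1]
  obtain ⟨w, b, -⟩ := exists_hilbertBasis ℂ H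
  simp_rw [hilbertSchmidtNorm_sq b]
  rw [← ENNReal.tsum_add]
  refine tsum_congr fun i => ?_
  have h2 : P - Q = P * (1 - Q) - (1 - P) * Q := by noncomm_ring
  have h3 : ⟪(P * (1 - Q)) (b i), ((1 - P) * Q) (b i)⟫_ℂ = 0 := by
    rw [← ContinuousLinearMap.adjoint_inner_right, ← ContinuousLinearMap.star_eq_adjoint,
      ← h1, star_star, ← ContinuousLinearMap.comp_apply, ← ContinuousLinearMap.mul_def,
      mul_assoc, ← mul_assoc P, hP.mul_one_sub_self]
    simp
  have h4 : ‖(P - Q) (b i)‖ ^ 2 =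
      ‖(P * (1 - Q)) (b i)‖ ^ 2 + ‖((1 - P) * Q) (b i)‖ ^ 2 := by
    rw [h2, sub_apply, @norm_sub_sq ℂ, h3]
    simp
  simp only [← ofReal_norm, ← ENNReal.ofReal_pow (norm_nonneg _)]
  rw [h4, ENNReal.ofReal_add (sq_nonneg _) (sq_nonneg _)]

lemma continuous_mulOfRange {T : H →ₗ.[ℂ] H} (hT : T.IsClosed) (P : H →L[ℂ] H)
    (h : ∀ x, P x ∈ T.domain) : Continuous (mulOfRange T P h) := by
  refine (mulOfRange T P h).continuous_of_seq_closed_graph fun u x y hu hTu => ?_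
  have hcl : _root_.IsClosed (T.graph : Set (H × H)) := hT
  have hmem : (P x, y) ∈ T.graph :=
    hcl.mem_of_tendsto (((P.continuous.tendsto x).comp hu).prodMk_nhds hTu)
      (Eventually.of_forall fun n => T.mem_graph ⟨P (u n), h (u n)⟩)
  obtain ⟨z, hz1, hz2⟩ := (LinearPMap.mem_graph_iff T).mp hmem
  simp only at hz1 hz2
  rw [← hz2]
  exact congrArg T (Subtype.ext hz1)

/-- The difference of two closed operators, multiplied from the right by a bounded operator into the
common domain, is bounded. -/
lemma exists_eq_mulOfRange_sub {A B : H →ₗ.[ℂ] H} (hA : A.IsClosed) (hB : B.IsClosed)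
    (P : H →L[ℂ] H) (h : ∀ x, P x ∈ (A - B).domain) :
    ∃ T : H →L[ℂ] H, (T : H →ₗ[ℂ] H) = mulOfRange (A - B) P h :=
  ⟨⟨mulOfRange A P fun x => (h x).1, continuous_mulOfRange hA P _⟩ -
    ⟨mulOfRange B P fun x => (h x).2, continuous_mulOfRange hB P _⟩, rfl⟩

/-- The one-sided estimate: on an eigenvector `e` of `A` for an eigenvalue `s ∈ Ω`, the operator
`A - B` acts as `s - B`, which is bounded below by `δ` on the kernel of `χ_Ω(B)`. -/
theorem mul_hilbertSchmidtNorm_one_sub_mul_le [TopologicalSpace.SeparableSpace H]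
    {A B : H →ₗ.[ℂ] H} (hA : IsSelfAdjoint A) (hB : IsSelfAdjoint B) {Ω : Set ℝ}
    (hΩ : MeasurableSet Ω) {δ : ℝ} (hδ : 0 ≤ δ)
    (hgap : ∀ s ∈ realSpectrum A ∩ Ω, ∀ t ∈ realSpectrum B \ Ω, δ ≤ dist s t)
    (hp : HasOnlyPointSpectrumIn A Ω)
    {T : H →L[ℂ] H} (hT : ∀ (x : A.domain) (y : B.domain), (x : H) = y →
      spectralProjection A hΩ x = x → T x = A x - B y)
    (hD : A.domain = B.domain) :
    ENNReal.ofReal δ ^ 2 * hilbertSchmidtNorm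
      (((1 - spectralProjection B hΩ) * spectralProjection A hΩ : H →L[ℂ] H) : H →ₗ[ℂ] H) ^ 2 ≤
      hilbertSchmidtNorm (T : H →ₗ[ℂ] H) ^ 2 := by
  obtain ⟨ι, b, hb⟩ := exists_hilbertBasis_eigenspace hA hΩ hp
  rw [hilbertSchmidtNorm_sq b, hilbertSchmidtNorm_sq b, ← ENNReal.tsum_mul_left]
  refine ENNReal.tsum_le_tsum fun i => ?_
  rcases hb i with h0 | ⟨s, hs, he⟩
  · simp [ContinuousLinearMap.mul_def, h0]
  · have hP := spectralProjection_apply_of_mem_eigenspace hA hΩ hs he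
    obtain ⟨heA, heA'⟩ := mem_eigenspace.mp he
    have heB : b i ∈ B.domain := hD ▸ heA
    have hne : b i ≠ 0 := b.orthonormal.ne_zero i
    have hsA : s ∈ realSpectrum A := eigenvalues_subset_realSpectrum A ⟨⟨b i, heA⟩, hne, heA'⟩
    have h1 := mul_norm_sub_spectralProjection_le hB hΩ hδ (hgap s ⟨hsA, hs⟩) ⟨b i, heB⟩
    have h2 := hT ⟨b i, heA⟩ ⟨b i, heB⟩ rfl hP
    simp only at h1 h2
    rw [heA'] at h2
    rw [norm_sub_rev (B ⟨b i, heB⟩), ← h2] at h1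
    have h3 : ((1 - spectralProjection B hΩ) * spectralProjection A hΩ) (b i) =
        b i - spectralProjection B hΩ (b i) := by
      simp [ContinuousLinearMap.mul_def, hP]
    rw [h3, ← mul_pow, ← ofReal_norm, ← ofReal_norm, ← ENNReal.ofReal_mul hδ]
    gcongr

end SpectralTheory

open SpectralTheory in
theorem proposition3p1 {H : Type*} [NormedAddCommGroup H] [InnerProductSpace ℂ H]
    [CompleteSpace H] [TopologicalSpace.SeparableSpace H]
    (A B : H →ₗ.[ℂ] H) (hA : IsSelfAdjoint A) (hB : IsSelfAdjoint B) (hD : A.domain = B.domain)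
    (Ω : Set ℝ) (hΩ : MeasurableSet Ω) (hΩb : Bornology.IsBounded Ω)
    (δ : ℝ) (hδ : 0 < δ)
    (hgapAB : ∀ s ∈ SpectralTheory.realSpectrum A ∩ Ω,
      ∀ t ∈ SpectralTheory.realSpectrum B \ Ω, δ ≤ dist s t)
    (hgapBA : ∀ s ∈ SpectralTheory.realSpectrum B ∩ Ω,
      ∀ t ∈ SpectralTheory.realSpectrum A \ Ω, δ ≤ dist s t)
    (hpA : SpectralTheory.HasOnlyPointSpectrumIn A Ω)
    (hpB : SpectralTheory.HasOnlyPointSpectrumIn B Ω) :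
    ∃ (hPA : ∀ x, SpectralTheory.spectralProjection A hΩ x ∈ (A - B).domain)
      (hPB : ∀ x, SpectralTheory.spectralProjection B hΩ x ∈ (A - B).domain),
      SpectralTheory.hilbertSchmidtNorm
          ((SpectralTheory.spectralProjection A hΩ - SpectralTheory.spectralProjection B hΩ :
            H →L[ℂ] H) : H →ₗ[ℂ] H) ≤
        (ENNReal.ofReal δ)⁻¹ *
          (SpectralTheory.hilbertSchmidtNorm
              (SpectralTheory.mulOfRange (A - B) (SpectralTheory.spectralProjection A hΩ) hPA) ^ 2 +
            SpectralTheory.hilbertSchmidtNorm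
              (SpectralTheory.mulOfRange (A - B) (SpectralTheory.spectralProjection B hΩ) hPB) ^ 2) ^
              (1 / 2 : ℝ) := by
  have hPA : ∀ x, spectralProjection A hΩ x ∈ (A - B).domain := fun x =>
    have h := spectralProjection_apply_mem_domain hA hΩ hΩb x
    ⟨h, hD ▸ h⟩
  have hPB : ∀ x, spectralProjection B hΩ x ∈ (A - B).domain := fun x =>
    have h := spectralProjection_apply_mem_domain hB hΩ hΩb x
    ⟨hD ▸ h, h⟩
  refine ⟨hPA, hPB, ?_⟩
  obtain ⟨S, hS⟩ := exists_eq_mulOfRange_sub hA.isClosed hB.isClosed _ hPA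
  obtain ⟨T, hT⟩ := exists_eq_mulOfRange_sub hA.isClosed hB.isClosed _ hPB
  have hval : ∀ {P L : H →L[ℂ] H} {h : ∀ x, P x ∈ (A - B).domain},
      (L : H →ₗ[ℂ] H) = mulOfRange (A - B) P h → ∀ (x : A.domain) (y : B.domain), (x : H) = y →
      P x = x → L x = A x - B y := by
    rintro P L h hL ⟨x, hx⟩ ⟨_, hy⟩ rfl hPx
    have h1 : L x = A ⟨P x, (h x).1⟩ - B ⟨P x, (h x).2⟩ := congrArg (fun L : H →ₗ[ℂ] H => L x) hL
    simp only at hPx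
    simp only [hPx] at h1
    exact h1
  have h1 := mul_hilbertSchmidtNorm_one_sub_mul_le hA hB hΩ hδ.le hgapAB hpA (hval hS) hD
  have h2 := mul_hilbertSchmidtNorm_one_sub_mul_le hB hA hΩ hδ.le hgapBA hpB (T := -T)
    (fun y x hyx hy => by
      rw [neg_apply, hyx, hval hT x y hyx.symm (by rw [← hyx]; exact hy), neg_sub]) hD.symm
  have hneg : hilbertSchmidtNorm ((-T : H →L[ℂ] H) : H →ₗ[ℂ] H) =
      hilbertSchmidtNorm (T : H →ₗ[ℂ] H) := by
    simp [hilbertSchmidtNorm]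
  have hδ0 : ENNReal.ofReal δ ≠ 0 := by simpa using hδ
  rw [hneg] at h2
  rw [← hS, ← hT, mul_comm, ← div_eq_mul_inv, ENNReal.le_div_iff_mul_le (Or.inl hδ0) (Or.inl
    ENNReal.ofReal_ne_top)]
  have hsqrt : ∀ a : ℝ≥0∞, a = (a ^ 2) ^ (1 / 2 : ℝ) := fun a => by
    rw [← ENNReal.rpow_natCast, ← ENNReal.rpow_mul]
    norm_num
  rw [hsqrt (_ * ENNReal.ofReal δ)]
  refine ENNReal.rpow_le_rpow ?_ (by norm_num)
  rw [mul_pow, mul_comm, hilbertSchmidtNorm_sub_sq (isStarProjection_spectralProjection A hΩ)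
    (isStarProjection_spectralProjection B hΩ), mul_add]
  exact add_le_add h1 h2
end
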